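/- **Setting.** Let $d\in\mathbb N_0$. Let $\Psi$ be a complex-valued function, defined on $-i\mathbb R^d$ and on a neighbourhood of $0$ in $\mathbb C^d$, holomorphic near $0$, with $\Psi(0)=0$, such that, for $\xi\in\mathbb R^d$, $\operatorname{Re}\Psi(-i\xi)\le c\log(1+\|\xi\|)$ for some constant $c$, and $\xi\mapsto\Psi(-i\xi)$ is smooth on $\mathbb R^d$ with all its partial derivatives polynomially bounded. Put $$C^{(n)}_{X_1\cdots X_n}=\frac{\partial^n\Psi}{\partial\xi_{X_1}\cdots\partial\xi_{X_n}}(0),\qquad X_1,\dots,X_n\in\{1,\dots,d\}.$$ Let $V(\varphi)=\sum_{p=0}^{\bar p}\sum_{X_1,\dots,X_p=1}^d\lambda^{(p)}_{X_1\cdots X_p}\varphi_{X_1}\cdots\varphi_{X_p}$ with real symmetric tensors $\lambda^{(p)}$ and $\bar p\ge 2$ even, and assume that the part of degree $\bar p$ of $V$ is positive for $\varphi\ne0$. For $t>0$ let $\nu_t\in\mathcal S'(\mathbb R^d)$ be the tempered distribution with Fourier transform $e^{t\Psi(-i\xi)}$, where $\mathcal F(g)(\xi)=\int g(\varphi)e^{i\langle\xi,\varphi\rangle}d\varphi$.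 For $\beta>0$ let $$\Phi_t^\beta(\phi)=(\nu_t*e^{-\beta V})(\phi)=\langle\nu_t,\,e^{-\beta V(\phi-\,\cdot\,)}\rangle .$$ **Feynman graphs.** For $m\in\mathbb N_0$ let $\bar F(m)$ be the set of graphs of the following kind. There are $m$ distinguishable full vertices; the $j$-th one has $p_j$ distinguishable legs, where $0\le p_j\le\bar p$ and $\lambda^{(p_j)}\neq0$. There are finitely many inner empty and outer empty vertices, which are indistinguishable within each of these two types. Each leg belongs to exactly one edge, which joins it to an empty vertex, and there are no other edges. Each inner empty vertex is met by at least one edge, each outer empty vertex by exactly one. $\bar F_c(m)\subseteq\bar F(m)$ is the subset of connected graphs. The value $\mathcal V[G](t,\phi)$ of $G\in\bar F(m)$ is obtained as follows: assign to each leg $a$ an index $X_a\in\{1,\dots,d\}$; multiply a factor $\phi_{X_a}$ for each outer empty vertex (joined to the leg $a$), a factor $t\,C^{(l)}_{X_{a_1}\cdots X_{a_l}}$ for each inner empty vertex (joined to the legs $a_1,\dots,a_l$), and a factor $\lambda^{(p_j)}_{X_1^j\cdots X_{p_j}^j}$ for the $j$-th full vertex (with $X_1^j,\dots,X_{p_j}^j$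 the indices of its legs); sum over all assignments. **Theorem.** Let $t>0$ and $\phi\in\mathbb R^d$. Then $\Phi_t^\beta(\phi)\neq0$ for all sufficiently small $\beta>0$, and, with the principal branch of the logarithm, $$\sum_{m=1}^\infty\beta^m\,\frac{(-1)^m}{m!}\sum_{G\in\bar F_c(m)}\mathcal V[G](t,\phi)$$ is an asymptotic series for $\log\Phi_t^\beta(\phi)$ at $\beta=0$, that is, for every $N\in\mathbb N_0$, $$\lim_{\beta\searrow0}\beta^{-N}\Bigl|\log\Phi_t^\beta(\phi)-\sum_{m=1}^N\beta^m\frac{(-1)^m}{m!}\sum_{G\in\bar F_c(m)}\mathcal V[G](t,\phi)\Bigr|=0 .$$ -/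

import Mathlib

open Filter Topology MeasureTheory

noncomputable section

namespace LevyFeynman

/-! ### The symbol and the convolution kernel -/

/-- Real Euclidean space `ℝ^d`. -/
abbrev RSpace (d : ℕ) : Type := EuclideanSpace ℝ (Fin d)

/-- Complex Euclidean space `ℂ^d`. -/
abbrev CSpace (d : ℕ) : Type := EuclideanSpace ℂ (Fin d)

/-- The vector `-iξ ∈ ℂ^d` for `ξ ∈ ℝ^d`. -/
def negI {d : ℕ} (ξ : RSpace d) : CSpace d :=
  WithLp.toLp 2 fun X => -Complex.I * ((ξ X : ℝ) : ℂ)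

/-- The function `ξ ↦ Ψ(-iξ)` on `ℝ^d`. -/
def symbolOnReal {d : ℕ} (Ψ : CSpace d → ℂ) (ξ : RSpace d) : ℂ := Ψ (negI ξ)

/-- Conditions (P1), (P2), (P3) on the symbol and the normalization `Ψ(0) = 0`.
The only values of `Ψ` that matter are those on `-iℝ^d` and the germ at `0`, which the values on
`-iℝ^d` near `0` determine by analytic continuation.
Mathlib's `Function.HasTemperateGrowth` says: smooth, and every derivative is polynomially
bounded. -/
structure IsAdmissibleSymbol {d : ℕ} (Ψ : CSpace d → ℂ) : Prop where
  zero : Ψ 0 = 0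
  analytic : AnalyticAt ℂ Ψ 0
  re_le : ∃ c : ℝ, ∀ ξ : RSpace d, (symbolOnReal Ψ ξ).re ≤ c * Real.log (1 + ‖ξ‖)
  growth : (symbolOnReal Ψ).HasTemperateGrowth

/-- The coefficients `C^{(n)}_{X_1 … X_n} = ∂ⁿΨ / ∂ξ_{X_1} ⋯ ∂ξ_{X_n} (0)` of the symbol. -/
def symbolCoeff {d : ℕ} (Ψ : CSpace d → ℂ) {n : ℕ} (X : Fin n → Fin d) : ℂ :=
  iteratedFDeriv ℂ n Ψ 0 fun i => EuclideanSpace.single (X i) (1 : ℂ)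

/-- Inverse of the Fourier transform `(ℱ g)(ξ) = ∫ g(φ) exp(i⟨ξ, φ⟩) dφ`, that is,
`(ℱ⁻¹ g)(ξ) = (2π)^{-d} ∫ g(φ) exp(-i⟨ξ, φ⟩) dφ`. -/
def fourierInverse {d : ℕ} (g : RSpace d → ℂ) (ξ : RSpace d) : ℂ :=
  (((2 * Real.pi) ^ d : ℝ) : ℂ)⁻¹ *
    ∫ φ : RSpace d, Complex.exp (-Complex.I * ((inner ℝ ξ φ : ℝ) : ℂ)) * g φ

/-- The value `⟨ν_t, g⟩` at a Schwartz function `g` of the tempered distribution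
`ν_t = ℱ⁻¹(exp(tΨ(-i·)))`; by the definition of the Fourier transform of distributions it is
`∫ exp(tΨ(-iξ)) (ℱ⁻¹ g)(ξ) dξ`. -/
def kernelPairing {d : ℕ} (Ψ : CSpace d → ℂ) (t : ℝ) (g : RSpace d → ℂ) : ℂ :=
  ∫ ξ : RSpace d, Complex.exp ((t : ℂ) * symbolOnReal Ψ ξ) * fourierInverse g ξ

/-! ### The initial condition and the solution -/

/-- Coefficient tensors: `lam p` holds the components `λ^{(p)}_{X_1 … X_p}`. -/
abbrev Tensors (d : ℕ) : Type := (p : ℕ) → (Fin p → Fin d) → ℝ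

/-- `⟨λ^{(p)}, φ^{⊗p}⟩`. -/
def homPart {d : ℕ} (lam : Tensors d) (p : ℕ) (φ : RSpace d) : ℝ :=
  ∑ X : Fin p → Fin d, lam p X * ∏ i, φ (X i)

/-- `V(φ) = ∑_{p ≤ p̄} ⟨λ^{(p)}, φ^{⊗p}⟩`. -/
def potential {d : ℕ} (lam : Tensors d) (pbar : ℕ) (φ : RSpace d) : ℝ :=
  ∑ p ∈ Finset.range (pbar + 1), homPart lam p φ

/-- `p̄` is a positive even number, all `λ^{(p)}` are symmetric, and the top-degree part of `V` is
positive away from `0`. -/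
structure IsAdmissiblePotential {d : ℕ} (lam : Tensors d) (pbar : ℕ) : Prop where
  pos : 0 < pbar
  even : Even pbar
  symm : ∀ (p : ℕ) (σ : Equiv.Perm (Fin p)) (X : Fin p → Fin d), lam p (X ∘ σ) = lam p X
  top_pos : ∀ φ : RSpace d, φ ≠ 0 → 0 < homPart lam pbar φ

/-- `Φ_t^β(ϕ) = (ν_t * exp(-βV))(ϕ)`, the convolution `⟨ν_t, exp(-βV(ϕ - ·))⟩`. -/
def solution {d : ℕ} (Ψ : CSpace d → ℂ) (lam : Tensors d) (pbar : ℕ) (t β : ℝ)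
    (ϕ : RSpace d) : ℂ :=
  kernelPairing Ψ t fun φ => ((Real.exp (-(β * potential lam pbar (ϕ - φ))) : ℝ) : ℂ)

/-- `∑ β^m a_m` is an asymptotic series, in the sense of Poincaré, for `h(β)`, `β > 0`, at
`β = 0`. -/
def IsAsymptoticSeries (h : ℝ → ℂ) (a : ℕ → ℂ) : Prop :=
  ∀ N : ℕ, Tendsto
    (fun β : ℝ => (β ^ N)⁻¹ * ‖h β - ∑ m ∈ Finset.range (N + 1), ((β : ℂ) ^ m) * a m‖)
    (𝓝[>] 0) (𝓝 0)

/-! ### Feynman graphs -/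

/-- The legs of `m` full vertices of which the `j`-th one has `p j` legs. -/
abbrev Legs {m : ℕ} (p : Fin m → ℕ) : Type := Σ j : Fin m, Fin (p j)

/-- A Feynman graph with numbered empty vertices. The full vertices are `0, …, m - 1`, their
legs are `Legs p`, there are `inner` inner empty and `outer` outer empty vertices. Every leg of a
full vertex belongs to exactly one edge, and `target` is the empty vertex at the other end of that
edge; there are no other edges. Every inner empty vertex is met by at least one edge, every outer
empty vertex by exactly one. -/
structure LabelledGraph {m : ℕ} (p : Fin m → ℕ) where
  inner : ℕ
  outer : ℕ
  target : Legs p → Fin inner ⊕ Fin outer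
  inner_met : ∀ v : Fin inner, ∃ a, target a = Sum.inl v
  outer_met : ∀ w : Fin outer, ∃! a, target a = Sum.inr w

namespace LabelledGraph

variable {m : ℕ} {p : Fin m → ℕ}

/-- `H` arises from `G` by renumbering the inner and the outer empty vertices. -/
def Relabel (G H : LabelledGraph p) : Prop :=
  ∃ (σ : Fin G.inner ≃ Fin H.inner) (τ : Fin G.outer ≃ Fin H.outer),
    ∀ a, H.target a = Equiv.sumCongr σ τ (G.target a)

instance setoid (p : Fin m → ℕ) : Setoid (LabelledGraph p) where
  r := Relabel
  iseqv :=
    { refl := fun G => ⟨Equiv.refl _, Equiv.refl _, fun a => by simp⟩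
      symm := by
        rintro G H ⟨σ, τ, h⟩
        refine ⟨σ.symm, τ.symm, fun a => ?_⟩
        rw [h a, ← Equiv.sumCongr_symm, Equiv.symm_apply_apply]
      trans := by
        rintro G H K ⟨σ, τ, h⟩ ⟨σ', τ', h'⟩
        refine ⟨σ.trans σ', τ.trans τ', fun a => ?_⟩
        rw [h' a, h a, ← Equiv.sumCongr_trans, Equiv.trans_apply] }

/-- The graph on all vertices (full, inner empty, outer empty) in which two vertices are adjacent
if an edge of `G` joins them. -/
def toSimpleGraph (G : LabelledGraph p) :
    SimpleGraph (Fin m ⊕ (Fin G.inner ⊕ Fin G.outer)) :=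
  SimpleGraph.fromRel fun u v => ∃ a : Legs p, u = Sum.inl a.1 ∧ v = Sum.inr (G.target a)

/-- Any two vertices are joined by a walk. -/
def IsConnected (G : LabelledGraph p) : Prop := G.toSimpleGraph.Connected

/-- The set of the legs that run into a given empty vertex. -/
def legsAt (G : LabelledGraph p) (e : Fin G.inner ⊕ Fin G.outer) : Finset (Legs p) :=
  Finset.univ.filter fun a => G.target a = e

/-- `C_J = C^{(l)}_{X_{a_1} … X_{a_l}}` for a set `J = {a_1, …, a_l}` of legs; the enumeration of
`J` does not matter, since partial derivatives commute. -/
def setCoeff {d : ℕ} (Ψ : CSpace d → ℂ) (X : Legs p → Fin d) (J : Finset (Legs p)) : ℂ :=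
  symbolCoeff Ψ fun i : Fin J.card => X (J.equivFin.symm i)

/-- The Feynman rules: a factor `λ^{(p_j)}_{X…}` for the `j`-th full vertex, a factor `ϕ_{X_a}`
for an outer empty vertex joined to the leg `a`, a factor `t C_J` for an inner empty vertex joined
to the set `J` of legs; sum over all assignments of values `X_a ∈ {1, …, d}` to the legs. -/
def value {d : ℕ} (Ψ : CSpace d → ℂ) (lam : Tensors d) (t : ℝ) (ϕ : RSpace d)
    (G : LabelledGraph p) : ℂ :=
  ∑ X : Legs p → Fin d,
    (∏ j : Fin m, ((lam (p j) fun i => X ⟨j, i⟩ : ℝ) : ℂ)) *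
    (∏ w : Fin G.outer, ∏ a ∈ G.legsAt (Sum.inr w), ((ϕ (X a) : ℝ) : ℂ)) *
    ∏ v : Fin G.inner, ((t : ℂ) * setCoeff Ψ X (G.legsAt (Sum.inl v)))

theorem legsAt_relabel {G H : LabelledGraph p} (e : Fin G.inner ≃ Fin H.inner)
    (f : Fin G.outer ≃ Fin H.outer)
    (h : ∀ a, H.target a = Equiv.sumCongr e f (G.target a)) (u : Fin G.inner ⊕ Fin G.outer) :
    H.legsAt (Equiv.sumCongr e f u) = G.legsAt u := by
  ext a
  simp only [legsAt, Finset.mem_filter, Finset.mem_univ, true_and, h a]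
  exact (Equiv.sumCongr e f).injective.eq_iff

theorem value_eq_of_relabel {d : ℕ} (Ψ : CSpace d → ℂ) (lam : Tensors d) (t : ℝ) (ϕ : RSpace d)
    (G H : LabelledGraph p) (hGH : G.Relabel H) :
    G.value Ψ lam t ϕ = H.value Ψ lam t ϕ := by
  obtain ⟨σ, τ, h⟩ := hGH
  unfold value
  refine Finset.sum_congr rfl fun X _ => ?_
  congr 1
  · congr 1
    refine Fintype.prod_equiv τ _ _ fun w => ?_
    have := legsAt_relabel σ τ h (Sum.inr w)
    simp only [Equiv.sumCongr_apply, Sum.map_inr] at this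
    rw [this]
  · refine Fintype.prod_equiv σ _ _ fun v => ?_
    have := legsAt_relabel σ τ h (Sum.inl v)
    simp only [Equiv.sumCongr_apply, Sum.map_inl] at this
    rw [this]

theorem isConnected_eq_of_relabel (G H : LabelledGraph p) (hGH : G.Relabel H) :
    G.IsConnected = H.IsConnected := by
  obtain ⟨σ, τ, h⟩ := hGH
  refine propext (SimpleGraph.Iso.connected_iff
    ⟨Equiv.sumCongr (Equiv.refl (Fin m)) (Equiv.sumCongr σ τ), ?_⟩)
  have key : ∀ (u : Fin G.inner ⊕ Fin G.outer) (a : Legs p),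
      Sum.map σ τ u = H.target a ↔ u = G.target a := by
    intro u a
    rw [h a]
    exact (Equiv.sumCongr σ τ).injective.eq_iff
  rintro (u | u) (v | v) <;> simp [toSimpleGraph, key]

instance finite (p : Fin m → ℕ) : Finite (LabelledGraph p) := by
  have hin : ∀ G : LabelledGraph p, G.inner < Fintype.card (Legs p) + 1 := by
    intro G
    choose s hs using G.inner_met
    have := Fintype.card_le_of_injective s fun v w hvw => by
      have := hs v
      rw [hvw, hs w] at this
      exact (Sum.inl_injective this).symm
    rw [Fintype.card_fin] at this
    omega
  have hout : ∀ G : LabelledGraph p, G.outer < Fintype.card (Legs p) + 1 := by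
    intro G
    choose s hs using fun w => (G.outer_met w).exists
    have := Fintype.card_le_of_injective s fun v w hvw => by
      have := hs v
      rw [hvw, hs w] at this
      exact (Sum.inr_injective this).symm
    rw [Fintype.card_fin] at this
    omega
  refine Finite.of_injective
    (β := Σ k : Fin (Fintype.card (Legs p) + 1), Σ l : Fin (Fintype.card (Legs p) + 1),
      (Legs p → Fin k ⊕ Fin l))
    (fun G => ⟨⟨G.inner, hin G⟩, ⟨G.outer, hout G⟩, G.target⟩) ?_
  rintro ⟨k, l, f, h1, h2⟩ ⟨k', l', f', h1', h2'⟩ hGH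
  simp only [Sigma.mk.injEq, Fin.mk.injEq] at hGH
  obtain ⟨rfl, hGH⟩ := hGH
  simp only [heq_eq_eq, Sigma.mk.injEq, Fin.mk.injEq] at hGH
  obtain ⟨rfl, hGH⟩ := hGH
  simp only [heq_eq_eq] at hGH
  subst hGH
  rfl

end LabelledGraph

/-- Generalized amputated Feynman graphs whose full vertices have `p_1, …, p_m` legs: the full
vertices and their legs are distinguishable, the empty vertices are not. -/
def FeynmanGraph {m : ℕ} (p : Fin m → ℕ) : Type := Quotient (LabelledGraph.setoid p)

namespace FeynmanGraph

variable {m : ℕ} {p : Fin m → ℕ}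

instance finite (p : Fin m → ℕ) : Finite (FeynmanGraph p) :=
  inferInstanceAs (Finite (Quotient (LabelledGraph.setoid p)))

/-- Connectedness of a Feynman graph. -/
def IsConnected (G : FeynmanGraph p) : Prop :=
  Quotient.lift LabelledGraph.IsConnected LabelledGraph.isConnected_eq_of_relabel G

/-- The value `𝒱[G](t, ϕ)` of a Feynman graph. -/
def value {d : ℕ} (Ψ : CSpace d → ℂ) (lam : Tensors d) (t : ℝ) (ϕ : RSpace d)
    (G : FeynmanGraph p) : ℂ :=
  Quotient.lift (LabelledGraph.value Ψ lam t ϕ)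
    (LabelledGraph.value_eq_of_relabel Ψ lam t ϕ) G

end FeynmanGraph

/-- The leg numbers that occur in order `m`: those with `p_j ≤ p̄` and `λ^{(p_j)} ≠ 0`. -/
abbrev LegNumbers {d : ℕ} (lam : Tensors d) (pbar m : ℕ) : Type :=
  {p : Fin m → ℕ // ∀ j, p j ≤ pbar ∧ lam (p j) ≠ 0}

instance LegNumbers.finite {d : ℕ} (lam : Tensors d) (pbar m : ℕ) :
    Finite (LegNumbers lam pbar m) :=
  Finite.of_injective
    (fun p : LegNumbers lam pbar m =>
      (fun j => ⟨p.1 j, Nat.lt_succ_of_le (p.2 j).1⟩ : Fin m → Fin (pbar + 1)))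
    fun _ _ h => Subtype.ext <| funext fun j => congrArg Fin.val (congrFun h j)

/-- The set `F̄(m)` of Feynman graphs of order `m`. -/
abbrev FeynmanGraphs {d : ℕ} (lam : Tensors d) (pbar m : ℕ) : Type :=
  Σ p : LegNumbers lam pbar m, FeynmanGraph p.1

/-- The set `F̄_c(m)` of connected Feynman graphs of order `m`. -/
abbrev ConnectedGraphs {d : ℕ} (lam : Tensors d) (pbar m : ℕ) : Type :=
  {G : FeynmanGraphs lam pbar m // G.2.IsConnected}

instance ConnectedGraphs.fintype {d : ℕ} (lam : Tensors d) (pbar m : ℕ) :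
    Fintype (ConnectedGraphs lam pbar m) := Fintype.ofFinite _

/-- The `m`-th coefficient `((-1)^m / m!) ∑_{G ∈ F̄_c(m)} 𝒱[G](t, ϕ)` for `m ≥ 1`, and `0` for
`m = 0`. -/
def connectedCoeff {d : ℕ} (Ψ : CSpace d → ℂ) (lam : Tensors d) (pbar : ℕ) (t : ℝ)
    (ϕ : RSpace d) (m : ℕ) : ℂ :=
  if m = 0 then 0
  else ((-1 : ℂ) ^ m / (m.factorial : ℂ)) *
    ∑ G : ConnectedGraphs lam pbar m, G.1.2.value Ψ lam t ϕ

end LevyFeynman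

end

/-!
The solution is an expectation of `exp (-β V)`, and the theorem says that the logarithm of its
expansion in `β` is given by the cumulants of `V`, which are sums over connected graphs.

*Analysis.* Let `W(ζ) = t Ψ(ζ) + ⟨ζ, ϕ⟩`. Parseval's identity writes the solution as the integral
of `exp (W(2πiη))` against the Fourier transform of `exp (-β V)`
(`solution_eq_integral_charFn_mul_fourier`). As the kernel is only a distribution, `exp (-β V)`
cannot be expanded under this pairing at once. However, with `ε ^ p̄ = β`, the function
`exp (-β V)` lives on the length scale `1 / ε`, so that its Fourier transform is, up to every power
of `ε`, concentrated near `0`, while the characteristic function grows at most polynomially. Cutting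
the characteristic function off smoothly away from `0` therefore changes the solution by
`O(β ^ N)` for every `N`, and replaces the kernel by a Schwartz function `ρ` with the same
derivatives of the characteristic function at `0`, that is, with the same moments. Under `ρ` Taylor's
formula for the exponential applies, because `β V` is bounded below; hence the solution has the
asymptotic series `∑ (-β) ^ m / m! ∫ V ^ m ρ` (`exists_density`).

*Combinatorics.* The formula of Faà di Bruno for `exp W` (`setDeriv_exp`) expresses the moments of
`ρ` by sums over set partitions, each block weighted by a derivative of `W` at `0`: a block `B`
contributes `t C_B`, and a singleton in addition a component of `ϕ`. A Feynman graph is a partition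
of the legs some of whose singletons (the outer empty vertices) are marked; summing over the marks
produces exactly these weights (`FeynmanGraph.sum_value_eq_sum_connectedSum`). Splitting off the
connected component of one full vertex shows that the sums over connected partitions obey the
recursion that defines joint cumulants from moments (`partitionSum_fiber_eq_sum_connectedSum`,
`eq_jointCumulant`). By multilinearity of joint cumulants the sum over the connected graphs with `m`
full vertices is the `m`-th cumulant of `V` under `ρ` (`sum_connectedGraphs_value_eq_cumulantSeq`).

*Logarithm.* The cumulants of a sequence of moments are defined by the recursion for the Taylor
coefficients of an exponential, so the exponential of the truncated cumulant series agrees with the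
truncated moment series up to `O(β ^ (N + 1))`. The solution tends to `1` as `β` tends to `0`, where
the principal logarithm is Lipschitz (`log_isBigO_of_moments`).
-/

noncomputable section

namespace LevyFeynman

/-! ### Set partitions and their connected components -/

section Partitions

/-- `P` is a partition of the finite set `S` into nonempty blocks. The blocks are kept in the
ambient type, so that partitions of different sets can be united and restricted without
transport. -/
def IsSetPartition {α : Type*} (P : Finset (Finset α)) (S : Finset α) : Prop :=
  ∅ ∉ P ∧ (∀ B ∈ P, B ⊆ S) ∧ ∀ a ∈ S, ∃! B, B ∈ P ∧ a ∈ B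

open scoped Classical in
/-- The finite set of all partitions of `S`. -/
def setPartitions {α : Type*} (S : Finset α) : Finset (Finset (Finset α)) :=
  S.powerset.powerset.filter fun P => IsSetPartition P S

/-- The sum over all partitions of `S` of the product of the weights of the blocks: the moments
that belong to the cumulants `w`. -/
def partitionSum {α : Type*} (w : Finset α → ℂ) (S : Finset α) : ℂ :=
  ∑ P ∈ setPartitions S, ∏ B ∈ P, w B

theorem mem_setPartitions {α : Type*} {P : Finset (Finset α)} {S : Finset α} :
    P ∈ setPartitions S ↔ IsSetPartition P S := by
  classical
  simp only [setPartitions, Finset.mem_filter, Finset.mem_powerset, and_iff_right_iff_imp]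
  intro h B hB
  exact Finset.mem_powerset.2 (h.2.1 B hB)

theorem IsSetPartition.nonempty {α : Type*} {P : Finset (Finset α)} {S B : Finset α}
    (h : IsSetPartition P S) (hB : B ∈ P) : B.Nonempty := by
  rw [Finset.nonempty_iff_ne_empty]
  rintro rfl
  exact h.1 hB

theorem IsSetPartition.eq_of_mem {α : Type*} {P : Finset (Finset α)} {S B C : Finset α} {a : α}
    (h : IsSetPartition P S) (hB : B ∈ P) (hC : C ∈ P) (haB : a ∈ B) (haC : a ∈ C) : B = C :=
  (h.2.2 a (h.2.1 B hB haB)).unique ⟨hB, haB⟩ ⟨hC, haC⟩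

theorem isSetPartition_singleton {α : Type*} {S : Finset α} (hS : S.Nonempty) :
    IsSetPartition {S} S := by
  refine ⟨?_, ?_, fun a ha => ⟨S, by simp [ha], ?_⟩⟩
  · simpa [eq_comm] using hS.ne_empty
  · simp
  · rintro B ⟨hB, -⟩
    simpa using hB

theorem IsSetPartition.disjoint {α : Type*} {P Q : Finset (Finset α)} {S T : Finset α}
    (hP : IsSetPartition P S) (hQ : IsSetPartition Q T) (hST : Disjoint S T) : Disjoint P Q := by
  rw [Finset.disjoint_left]
  intro B hB hB'
  obtain ⟨a, ha⟩ := hP.nonempty hB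
  exact Finset.disjoint_left.1 hST (hP.2.1 B hB ha) (hQ.2.1 B hB' ha)

theorem IsSetPartition.union {α : Type*} [DecidableEq α] {P Q : Finset (Finset α)}
    {S T : Finset α} (hP : IsSetPartition P S) (hQ : IsSetPartition Q T) (hST : Disjoint S T) :
    IsSetPartition (P ∪ Q) (S ∪ T) := by
  refine ⟨?_, ?_, ?_⟩
  · simp [hP.1, hQ.1]
  · intro B hB
    rcases Finset.mem_union.1 hB with h | h
    · exact (hP.2.1 B h).trans Finset.subset_union_left
    · exact (hQ.2.1 B h).trans Finset.subset_union_right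
  · intro a ha
    rcases Finset.mem_union.1 ha with h | h
    · obtain ⟨B, ⟨hB, haB⟩, hu⟩ := hP.2.2 a h
      refine ⟨B, ⟨Finset.mem_union_left _ hB, haB⟩, ?_⟩
      rintro C ⟨hC, haC⟩
      rcases Finset.mem_union.1 hC with hC | hC
      · exact hu C ⟨hC, haC⟩
      · exact absurd (hQ.2.1 C hC haC) (Finset.disjoint_left.1 hST h)
    · obtain ⟨B, ⟨hB, haB⟩, hu⟩ := hQ.2.2 a h
      refine ⟨B, ⟨Finset.mem_union_right _ hB, haB⟩, ?_⟩
      rintro C ⟨hC, haC⟩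
      rcases Finset.mem_union.1 hC with hC | hC
      · exact absurd h (Finset.disjoint_left.1 hST (hP.2.1 C hC haC))
      · exact hu C ⟨hC, haC⟩

theorem IsSetPartition.filter_subset {α : Type*} [DecidableEq α] {P : Finset (Finset α)}
    {S T : Finset α} (hP : IsSetPartition P S) (hT : T ⊆ S)
    (h : ∀ B ∈ P, B ⊆ T ∨ Disjoint B T) :
    IsSetPartition (P.filter (· ⊆ T)) T := by
  refine ⟨fun h0 => hP.1 (Finset.mem_filter.1 h0).1, fun B hB => (Finset.mem_filter.1 hB).2, ?_⟩
  intro a ha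
  obtain ⟨B, ⟨hB, haB⟩, hu⟩ := hP.2.2 a (hT ha)
  refine ⟨B, ⟨Finset.mem_filter.2 ⟨hB, ?_⟩, haB⟩, fun C hC =>
    hu C ⟨(Finset.mem_filter.1 hC.1).1, hC.2⟩⟩
  exact (h B hB).resolve_right fun hd => Finset.disjoint_left.1 hd haB ha

theorem IsSetPartition.filter_union_filter {α : Type*} [DecidableEq α] {P : Finset (Finset α)}
    {S T : Finset α} (hP : IsSetPartition P S)
    (h : ∀ B ∈ P, B ⊆ T ∨ Disjoint B T) :
    P.filter (· ⊆ T) ∪ P.filter (· ⊆ S \ T) = P := by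
  ext B
  simp only [Finset.mem_union, Finset.mem_filter]
  constructor
  · rintro (h | h) <;> exact h.1
  · intro hB
    rcases h B hB with h | h
    · exact Or.inl ⟨hB, h⟩
    · exact Or.inr ⟨hB, Finset.subset_sdiff.2 ⟨hP.2.1 B hB, h⟩⟩

theorem IsSetPartition.filter_union_left {α : Type*} [DecidableEq α] {P Q : Finset (Finset α)}
    {S T : Finset α} (hP : IsSetPartition P S) (hQ : IsSetPartition Q T) (hST : Disjoint S T) :
    (P ∪ Q).filter (· ⊆ S) = P := by
  ext B
  simp only [Finset.mem_union, Finset.mem_filter]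
  constructor
  · rintro ⟨h | h, hS⟩
    · exact h
    · obtain ⟨a, ha⟩ := hQ.nonempty h
      exact absurd (hQ.2.1 B h ha) (Finset.disjoint_left.1 hST (hS ha))
  · exact fun h => ⟨Or.inl h, hP.2.1 B h⟩

theorem partitionSum_empty {α : Type*} (w : Finset α → ℂ) : partitionSum w ∅ = 1 := by
  have : setPartitions (∅ : Finset α) = {∅} := by
    ext P
    rw [mem_setPartitions, Finset.mem_singleton]
    constructor
    · intro h
      refine Finset.eq_empty_of_forall_notMem fun B hB => ?_
      obtain ⟨a, ha⟩ := h.nonempty hB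
      simpa using h.2.1 B hB ha
    · rintro rfl
      simp [IsSetPartition]
  simp [partitionSum, this]

/-- Recursion for partition sums: choose the block that contains `a`. -/
theorem partitionSum_insert {α : Type*} [DecidableEq α] (w : Finset α → ℂ) {a : α}
    {S : Finset α} (ha : a ∉ S) :
    partitionSum w (insert a S) =
      ∑ T ∈ S.powerset, w (insert a T) * partitionSum w (S \ T) := by
  simp only [partitionSum, Finset.mul_sum]
  rw [Finset.sum_sigma' S.powerset (fun T => setPartitions (S \ T))]
  have hins : ∀ T ⊆ S, insert a T ∪ S \ T = insert a S := by
    intro T hT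
    rw [Finset.insert_union, Finset.union_sdiff_of_subset hT]
  have hdisj : ∀ T ⊆ S, Disjoint (insert a T) (S \ T) := by
    intro T hT
    rw [Finset.disjoint_insert_left]
    exact ⟨fun h => ha (Finset.mem_sdiff.1 h).1, Finset.disjoint_sdiff⟩
  have hsing : ∀ T : Finset α, IsSetPartition {insert a T} (insert a T) := fun T =>
    isSetPartition_singleton (Finset.insert_nonempty a T)
  symm
  refine Finset.sum_bij (fun x _ => {insert a x.1} ∪ x.2) ?_ ?_ ?_ ?_
  · rintro ⟨T, P⟩ hx
    simp only [Finset.mem_sigma, Finset.mem_powerset, mem_setPartitions] at hx ⊢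
    rw [← hins T hx.1]
    exact (hsing T).union hx.2 (hdisj T hx.1)
  · rintro ⟨T, P⟩ hx ⟨T', P'⟩ hx' heq
    simp only [Finset.mem_sigma, Finset.mem_powerset, mem_setPartitions] at hx hx' heq
    have h1 := (hsing T).union hx.2 (hdisj T hx.1)
    have haT : insert a T = insert a T' := by
      refine h1.eq_of_mem (a := a) (by simp) ?_ (by simp) (by simp)
      rw [heq]
      simp
    have hTT : T = T' := by
      rw [← Finset.erase_insert (fun h => ha (hx.1 h)), haT,
        Finset.erase_insert (fun h => ha (hx'.1 h))]
    subst hTT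
    have h2 := hx.2.filter_union_left (hsing T) (hdisj T hx.1).symm
    have h3 := hx'.2.filter_union_left (hsing T) (hdisj T hx.1).symm
    rw [Finset.union_comm] at h2 h3
    have : P = P' := by rw [← h2, heq, h3]
    rw [this]
  · intro P hP
    rw [mem_setPartitions] at hP
    obtain ⟨B, ⟨hB, haB⟩, hu⟩ := hP.2.2 a (Finset.mem_insert_self a S)
    have hBS : B.erase a ⊆ S := by
      intro b hb
      rw [Finset.mem_erase] at hb
      exact (Finset.mem_insert.1 (hP.2.1 B hB hb.2)).resolve_left hb.1
    have hiB : insert a (B.erase a) = B := Finset.insert_erase haB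
    have hsd : insert a S \ B = S \ B.erase a := by
      ext b
      simp only [Finset.mem_sdiff, Finset.mem_insert, Finset.mem_erase]
      constructor
      · rintro ⟨rfl | h, hb⟩
        · exact absurd haB hb
        · exact ⟨h, fun h' => hb h'.2⟩
      · rintro ⟨h, hb⟩
        exact ⟨Or.inr h, fun h' => hb ⟨fun e => ha (e ▸ h), h'⟩⟩
    have hcl : ∀ C ∈ P, C ⊆ B ∨ Disjoint C B := by
      intro C hC
      by_cases hCB : C = B
      · exact Or.inl hCB.le
      · exact Or.inr (Finset.disjoint_left.2 fun b hbC hbB =>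
          hCB (hP.eq_of_mem hC hB hbC hbB))
    have hcl' : ∀ C ∈ P, C ⊆ insert a S \ B ∨ Disjoint C (insert a S \ B) := by
      intro C hC
      rcases hcl C hC with h | h
      · exact Or.inr (Finset.disjoint_of_subset_left h Finset.disjoint_sdiff)
      · exact Or.inl (Finset.subset_sdiff.2 ⟨hP.2.1 C hC, h⟩)
    have hfB : P.filter (· ⊆ B) = {B} := by
      ext C
      simp only [Finset.mem_filter, Finset.mem_singleton]
      constructor
      · rintro ⟨hC, hCB⟩
        obtain ⟨b, hb⟩ := hP.nonempty hC
        exact hP.eq_of_mem hC hB hb (hCB hb)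
      · rintro rfl
        exact ⟨hB, subset_rfl⟩
    refine ⟨⟨B.erase a, P.filter (· ⊆ insert a S \ B)⟩, ?_, ?_⟩
    · simp only [Finset.mem_sigma, Finset.mem_powerset, mem_setPartitions]
      refine ⟨hBS, ?_⟩
      rw [← hsd]
      exact hP.filter_subset Finset.sdiff_subset hcl'
    · simp only [hiB]
      rw [← hfB]
      exact hP.filter_union_filter hcl
  · rintro ⟨T, P⟩ hx
    simp only [Finset.mem_sigma, Finset.mem_powerset, mem_setPartitions] at hx ⊢
    rw [Finset.prod_union ((hsing T).disjoint hx.2 (hdisj T hx.1)), Finset.prod_singleton]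

/-- The legs that belong to the vertices in `T`. -/
def fiber {α ι : Type*} [Fintype α] [DecidableEq ι] (π : α → ι) (T : Finset ι) : Finset α :=
  Finset.univ.filter fun a => π a ∈ T

/-- No block of `P` joins a vertex in `T` to a vertex outside `T`. -/
def IsClosedUnder {α ι : Type*} [Fintype α] [DecidableEq ι] (π : α → ι)
    (P : Finset (Finset α)) (T : Finset ι) : Prop :=
  ∀ B ∈ P, B ⊆ fiber π T ∨ Disjoint B (fiber π T)

/-- The blocks of `P` connect the vertices in `S`: a nonempty set of vertices in `S` that no block
leaves is all of `S`. -/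
def IsConnectedOn {α ι : Type*} [Fintype α] [DecidableEq ι] (π : α → ι)
    (P : Finset (Finset α)) (S : Finset ι) : Prop :=
  S.Nonempty ∧ ∀ T ⊆ S, T.Nonempty → IsClosedUnder π P T → T = S

open scoped Classical in
/-- The part of the partition sum over the legs of `S` that comes from the connected partitions. -/
def connectedSum {α ι : Type*} [Fintype α] [DecidableEq ι] (π : α → ι)
    (w : Finset α → ℂ) (S : Finset ι) : ℂ :=
  ∑ P ∈ (setPartitions (fiber π S)).filter (fun P => IsConnectedOn π P S), ∏ B ∈ P, w B

section

variable {α ι : Type*} [Fintype α] [DecidableEq ι] {π : α → ι}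
  {P Q : Finset (Finset α)} {S T U : Finset ι}

@[simp]
theorem mem_fiber {a : α} : a ∈ fiber π T ↔ π a ∈ T := by simp [fiber]

theorem fiber_mono (h : T ⊆ S) : fiber π T ⊆ fiber π S := fun a ha => by
  rw [mem_fiber] at ha ⊢
  exact h ha

theorem disjoint_fiber (h : Disjoint S T) : Disjoint (fiber π S) (fiber π T) := by
  rw [Finset.disjoint_left] at h ⊢
  intro a ha hb
  rw [mem_fiber] at ha hb
  exact h ha hb

theorem isClosedUnder_self (hP : IsSetPartition P (fiber π S)) : IsClosedUnder π P S :=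
  fun B hB => Or.inl (hP.2.1 B hB)

variable [DecidableEq α]

theorem fiber_sdiff : fiber π (S \ T) = fiber π S \ fiber π T := by
  ext a
  simp

theorem IsClosedUnder.inter (hT : IsClosedUnder π P T) (hU : IsClosedUnder π P U) :
    IsClosedUnder π P (T ∩ U) := by
  intro B hB
  have : fiber π (T ∩ U) = fiber π T ∩ fiber π U := by
    ext a
    simp
  rw [this]
  rcases hT B hB with h | h
  · rcases hU B hB with h' | h'
    · exact Or.inl (Finset.subset_inter h h')
    · exact Or.inr (Finset.disjoint_of_subset_right Finset.inter_subset_right h')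
  · exact Or.inr (Finset.disjoint_of_subset_right Finset.inter_subset_left h)

theorem IsClosedUnder.sdiff (hP : IsSetPartition P (fiber π S)) (hS : IsClosedUnder π P T) :
    IsClosedUnder π P (S \ T) := by
  intro B hB
  rw [fiber_sdiff]
  rcases hS B hB with h | h
  · exact Or.inr (Finset.disjoint_of_subset_left h Finset.disjoint_sdiff)
  · exact Or.inl (Finset.subset_sdiff.2 ⟨hP.2.1 B hB, h⟩)

/-- Inside a closed set `T`, closedness only concerns the blocks in `T`. -/
theorem isClosedUnder_filter_iff (hT : IsClosedUnder π P T) (hU : U ⊆ T) :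
    IsClosedUnder π (P.filter (· ⊆ fiber π T)) U ↔ IsClosedUnder π P U := by
  refine ⟨fun h B hB => ?_, fun h B hB => h B (Finset.mem_filter.1 hB).1⟩
  rcases hT B hB with h' | h'
  · exact h B (Finset.mem_filter.2 ⟨hB, h'⟩)
  · exact Or.inr (Finset.disjoint_of_subset_right (fiber_mono hU) h')

/-- The connected component of a vertex `s`. -/
theorem exists_component (hP : IsSetPartition P (fiber π S)) {s : ι} (hs : s ∈ S) :
    ∃ T ⊆ S, s ∈ T ∧ IsClosedUnder π P T ∧
      IsConnectedOn π (P.filter (· ⊆ fiber π T)) T := by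
  classical
  obtain ⟨T, hT, hmin⟩ := Finset.exists_min_image
    (S.powerset.filter fun T => s ∈ T ∧ IsClosedUnder π P T) Finset.card
    ⟨S, by simp [hs, isClosedUnder_self hP]⟩
  simp only [Finset.mem_filter, Finset.mem_powerset] at hT hmin
  obtain ⟨hTS, hsT, hTc⟩ := hT
  refine ⟨T, hTS, hsT, hTc, ⟨s, hsT⟩, fun U hU hne hUc => ?_⟩
  rw [isClosedUnder_filter_iff hTc hU] at hUc
  by_cases hsU : s ∈ U
  · exact Finset.eq_of_subset_of_card_le hU (hmin U ⟨hU.trans hTS, hsU, hUc⟩)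
  · have hdc : IsClosedUnder π P (T \ U) := by
      have : T \ U = T ∩ (S \ U) := by
        ext a
        simp only [Finset.mem_sdiff, Finset.mem_inter]
        exact ⟨fun h => ⟨h.1, hTS h.1, h.2⟩, fun h => ⟨h.1, h.2.2⟩⟩
      rw [this]
      exact hTc.inter (hUc.sdiff hP)
    have := hmin (T \ U) ⟨Finset.sdiff_subset.trans hTS, Finset.mem_sdiff.2 ⟨hsT, hsU⟩, hdc⟩
    have hlt : (T \ U).card < T.card := by
      refine Finset.card_lt_card ⟨Finset.sdiff_subset, fun h => ?_⟩
      obtain ⟨u, hu⟩ := hne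
      exact (Finset.mem_sdiff.1 (h (hU hu))).2 hu
    omega

theorem component_unique {s : ι} (hT : IsClosedUnder π P T) (hU : IsClosedUnder π P U)
    (hsT : s ∈ T) (hsU : s ∈ U) (hTc : IsConnectedOn π (P.filter (· ⊆ fiber π T)) T)
    (hUc : IsConnectedOn π (P.filter (· ⊆ fiber π U)) U) : T = U := by
  have hne : (T ∩ U).Nonempty := ⟨s, Finset.mem_inter.2 ⟨hsT, hsU⟩⟩
  have h1 := hTc.2 (T ∩ U) Finset.inter_subset_left hne
    ((isClosedUnder_filter_iff hT Finset.inter_subset_left).2 (hT.inter hU))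
  have h2 := hUc.2 (T ∩ U) Finset.inter_subset_right hne
    ((isClosedUnder_filter_iff hU Finset.inter_subset_right).2 (hT.inter hU))
  rw [← h1, h2]

/-- Splitting off the connected component of a vertex `s`: partition sums are related to their
connected parts as moments to cumulants. -/
theorem partitionSum_fiber_eq_sum_connectedSum (π : α → ι) (w : Finset α → ℂ) (S : Finset ι)
    {s : ι} (hs : s ∈ S) :
    partitionSum w (fiber π S) = ∑ T ∈ S.powerset.filter (s ∈ ·),
      connectedSum π w T * partitionSum w (fiber π (S \ T)) := by
  classical
  simp only [partitionSum, connectedSum, Finset.sum_mul_sum, ← Finset.sum_product']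
  rw [Finset.sum_sigma' (S.powerset.filter (s ∈ ·)) (fun T =>
    ((setPartitions (fiber π T)).filter fun P => IsConnectedOn π P T) ×ˢ
      setPartitions (fiber π (S \ T)))]
  have hdisj : ∀ T : Finset ι, Disjoint (fiber π T) (fiber π (S \ T)) := fun T =>
    disjoint_fiber Finset.disjoint_sdiff
  have hunion : ∀ T ⊆ S, fiber π T ∪ fiber π (S \ T) = fiber π S := by
    intro T hT
    rw [fiber_sdiff, Finset.union_sdiff_of_subset (fiber_mono hT)]
  have hclosed : ∀ (T : Finset ι) (P Q : Finset (Finset α)), IsSetPartition P (fiber π T) →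
      IsSetPartition Q (fiber π (S \ T)) → IsClosedUnder π (P ∪ Q) T := by
    intro T P Q hP hQ B hB
    rcases Finset.mem_union.1 hB with h | h
    · exact Or.inl (hP.2.1 B h)
    · exact Or.inr (Finset.disjoint_of_subset_left (hQ.2.1 B h) (hdisj T).symm)
  symm
  refine Finset.sum_bij (fun x _ => x.2.1 ∪ x.2.2) ?_ ?_ ?_ ?_
  · rintro ⟨T, P, Q⟩ hx
    simp only [Finset.mem_sigma, Finset.mem_product, Finset.mem_filter, Finset.mem_powerset,
      mem_setPartitions] at hx ⊢
    rw [← hunion T hx.1.1]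
    exact hx.2.1.1.union hx.2.2 (hdisj T)
  · rintro ⟨T, P, Q⟩ hx ⟨T', P', Q'⟩ hx' heq
    simp only [Finset.mem_sigma, Finset.mem_product, Finset.mem_filter, Finset.mem_powerset,
      mem_setPartitions] at hx hx' heq
    obtain ⟨⟨hT, hsT⟩, ⟨hP, hPc⟩, hQ⟩ := hx
    obtain ⟨⟨hT', hsT'⟩, ⟨hP', hPc'⟩, hQ'⟩ := hx'
    have e1 := hP.filter_union_left hQ (hdisj T)
    have e1' := hP'.filter_union_left hQ' (hdisj T')
    have hTT : T = T' := by
      refine component_unique (P := P ∪ Q) (hclosed T P Q hP hQ) ?_ hsT hsT' ?_ ?_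
      · rw [heq]
        exact hclosed T' P' Q' hP' hQ'
      · rwa [e1]
      · rwa [heq, e1']
    subst hTT
    have e2 := hQ.filter_union_left hP (hdisj T).symm
    have e2' := hQ'.filter_union_left hP' (hdisj T).symm
    rw [Finset.union_comm] at e2 e2'
    have hPP : P = P' := by rw [← e1, heq, e1']
    have hQQ : Q = Q' := by rw [← e2, heq, e2']
    rw [hPP, hQQ]
  · intro P hP
    rw [mem_setPartitions] at hP
    obtain ⟨T, hTS, hsT, hTc, hTconn⟩ := exists_component hP hs
    refine ⟨⟨T, P.filter (· ⊆ fiber π T), P.filter (· ⊆ fiber π (S \ T))⟩, ?_, ?_⟩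
    · simp only [Finset.mem_sigma, Finset.mem_product, Finset.mem_filter, Finset.mem_powerset,
        mem_setPartitions]
      exact ⟨⟨hTS, hsT⟩, ⟨hP.filter_subset (fiber_mono hTS) hTc, hTconn⟩,
        hP.filter_subset (fiber_mono Finset.sdiff_subset) (hTc.sdiff hP)⟩
    · simp only
      rw [fiber_sdiff]
      exact hP.filter_union_filter hTc
  · rintro ⟨T, P, Q⟩ hx
    simp only [Finset.mem_sigma, Finset.mem_product, Finset.mem_filter, Finset.mem_powerset,
      mem_setPartitions] at hx ⊢
    rw [Finset.prod_union (hx.2.1.1.disjoint hx.2.2 (hdisj T))]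

end

end Partitions

/-! ### Mixed derivatives indexed by finite sets and the derivatives of an exponential -/

section SetDeriv

variable {E α : Type*} [NormedAddCommGroup E] [NormedSpace ℂ E] {v : α → E} {S : Finset α}
  {f g : E → ℂ} {x : E}

/-- The mixed derivative of `f` at `x` along the directions `v a`, `a ∈ S`. The enumeration of `S`
is immaterial where `f` is analytic. -/
def setDeriv (v : α → E) (S : Finset α) (f : E → ℂ) (x : E) : ℂ :=
  iteratedFDeriv ℂ S.card f x fun i => v (S.equivFin.symm i)

theorem iteratedFDeriv_eq_setDeriv (hf : AnalyticAt ℂ f x) {n : ℕ} (e : Fin n ≃ S) :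
    iteratedFDeriv ℂ n f x (fun i => v (e i)) = setDeriv v S f x := by
  obtain rfl : n = S.card := by simpa using Fintype.card_congr e
  have h := hf.contDiffAt (n := ⊤)
  rw [setDeriv, ← ContDiffAt.iteratedFDeriv_comp_perm h (fun i => v (S.equivFin.symm i))
    (e.trans S.equivFin)]
  congr 1
  ext i
  simp

theorem setDeriv_empty : setDeriv v ∅ f x = f x := by
  have : ∀ (n : ℕ) (m : Fin n → E), n = 0 → iteratedFDeriv ℂ n f x m = f x := by
    rintro n m rfl
    simp
  exact this _ _ rfl

theorem setDeriv_congr (h : f =ᶠ[𝓝 x] g) : setDeriv v S f x = setDeriv v S g x := by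
  rw [setDeriv, setDeriv, (h.iteratedFDeriv ℂ S.card).eq_of_nhds]

theorem setDeriv_add (hf : AnalyticAt ℂ f x) (hg : AnalyticAt ℂ g x) :
    setDeriv v S (fun y => f y + g y) x = setDeriv v S f x + setDeriv v S g x := by
  rw [setDeriv, setDeriv, setDeriv]
  have := iteratedFDeriv_add_apply (i := S.card) (hf.contDiffAt) (hg.contDiffAt)
  rw [show (fun y => f y + g y) = f + g from rfl, this]
  rfl

theorem analyticAt_fderiv_apply (hf : AnalyticAt ℂ f x) (u : E) :
    AnalyticAt ℂ (fun y => fderiv ℂ f y u) x :=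
  (ContinuousLinearMap.analyticAt (ContinuousLinearMap.apply ℂ ℂ u) (fderiv ℂ f x)).fun_comp
    hf.fderiv

theorem setDeriv_insert [DecidableEq α] (hf : AnalyticAt ℂ f x) {a : α} (ha : a ∉ S) :
    setDeriv v (insert a S) f x = setDeriv v S (fun y => fderiv ℂ f y (v a)) x := by
  classical
  let e : Fin (S.card + 1) ≃ (insert a S : Finset α) :=
    finSuccEquivLast.trans ((Equiv.optionCongr S.equivFin.symm).trans
      (Finset.subtypeInsertEquivOption ha).symm)
  rw [← iteratedFDeriv_eq_setDeriv hf e, iteratedFDeriv_succ_apply_right]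
  have hc : ContDiffAt ℂ S.card (fderiv ℂ f) x := hf.fderiv.contDiffAt
  have happ := ContinuousLinearMap.iteratedFDeriv_comp_left
    (ContinuousLinearMap.apply ℂ ℂ (v a)) hc le_rfl
  rw [setDeriv, show (fun y => fderiv ℂ f y (v a)) =
    (ContinuousLinearMap.apply ℂ ℂ (v a)) ∘ fderiv ℂ f from rfl, happ]
  have hinit : (Fin.init fun i => v (e i)) = fun i => v (S.equivFin.symm i) := by
    ext i
    simp only [Fin.init, e, Equiv.trans_apply, finSuccEquivLast_castSucc]
    rfl
  have hlast : v (e (Fin.last S.card)) = v a := by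
    simp only [e, Equiv.trans_apply, finSuccEquivLast_last]
    rfl
  rw [hinit, hlast]
  rfl

/-- Leibniz' rule. -/
theorem setDeriv_mul [DecidableEq α] (v : α → E) (S : Finset α) (hf : AnalyticAt ℂ f x)
    (hg : AnalyticAt ℂ g x) :
    setDeriv v S (fun y => f y * g y) x =
      ∑ T ∈ S.powerset, setDeriv v T f x * setDeriv v (S \ T) g x := by
  induction S using Finset.induction_on generalizing f g with
  | empty => simp [setDeriv_empty]
  | insert a S ha ih =>
    have hf' := analyticAt_fderiv_apply hf (v a)
    have hg' := analyticAt_fderiv_apply hg (v a)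
    rw [setDeriv_insert (hf.fun_mul hg) ha, Finset.sum_powerset_insert ha]
    have h : (fun y => fderiv ℂ (fun y => f y * g y) y (v a)) =ᶠ[𝓝 x]
        fun y => f y * fderiv ℂ g y (v a) + fderiv ℂ f y (v a) * g y := by
      filter_upwards [hf.eventually_analyticAt, hg.eventually_analyticAt] with y hfy hgy
      rw [fderiv_fun_mul hfy.differentiableAt hgy.differentiableAt]
      simp [mul_comm]
    rw [setDeriv_congr h, setDeriv_add (hf.fun_mul hg') (hf'.fun_mul hg), ih hf hg', ih hf' hg]
    congr 1
    · refine Finset.sum_congr rfl fun T hT => ?_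
      have hT := Finset.mem_powerset.1 hT
      rw [Finset.insert_sdiff_of_notMem _ fun h => ha (hT h),
        setDeriv_insert hg fun h => ha (Finset.mem_sdiff.1 h).1]
    · refine Finset.sum_congr rfl fun T hT => ?_
      have hT := Finset.mem_powerset.1 hT
      rw [setDeriv_insert hf fun h => ha (hT h)]
      congr 2
      ext b
      simp only [Finset.mem_sdiff, Finset.mem_insert]
      constructor
      · rintro ⟨hb, hbT⟩
        exact ⟨Or.inr hb, by rintro (rfl | h); exacts [ha hb, hbT h]⟩
      · rintro ⟨hb, hbT⟩
        push Not at hbT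
        exact ⟨hb.resolve_left hbT.1, hbT.2⟩

/-- The formula of Faà di Bruno for the exponential: moments are partition sums of cumulants. -/
theorem setDeriv_exp [DecidableEq α] (v : α → E) (S : Finset α) (hf : AnalyticAt ℂ f x) :
    setDeriv v S (fun y => Complex.exp (f y)) x =
      partitionSum (fun B => setDeriv v B f x) S * Complex.exp (f x) := by
  induction S using Finset.strongInduction with
  | H S ih =>
    rcases S.eq_empty_or_nonempty with rfl | ⟨a, ha⟩
    · simp [setDeriv_empty, partitionSum_empty]
    obtain ⟨S, ha', rfl⟩ : ∃ S', a ∉ S' ∧ insert a S' = S :=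
      ⟨S.erase a, Finset.notMem_erase a S, Finset.insert_erase ha⟩
    have h : (fun y => fderiv ℂ (fun y => Complex.exp (f y)) y (v a)) =ᶠ[𝓝 x]
        fun y => fderiv ℂ f y (v a) * Complex.exp (f y) := by
      filter_upwards [hf.eventually_analyticAt] with y hfy
      rw [hfy.differentiableAt.hasFDerivAt.cexp.fderiv]
      simp [mul_comm]
    rw [setDeriv_insert (f := fun y => Complex.exp (f y)) hf.cexp ha', setDeriv_congr h,
      setDeriv_mul v S (analyticAt_fderiv_apply hf (v a))
        (g := fun y => Complex.exp (f y)) hf.cexp, partitionSum_insert _ ha',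
      Finset.sum_mul]
    refine Finset.sum_congr rfl fun T hT => ?_
    have hT := Finset.mem_powerset.1 hT
    rw [ih (S \ T) (Finset.ssubset_of_subset_of_ssubset Finset.sdiff_subset
      (Finset.ssubset_insert ha')), setDeriv_insert hf fun h => ha' (hT h)]
    ring

end SetDeriv

/-! ### Moments of the Fourier transform of a Schwartz function -/

section Moments

open scoped SchwartzMap LineDeriv FourierTransform

variable {d : ℕ}

/-- The embedding `η ↦ 2πiη` of `ℝ^d` into `ℂ^d`. -/
def imagEmbedding (d : ℕ) : RSpace d →L[ℝ] CSpace d :=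
  LinearMap.toContinuousLinearMap
    { toFun := fun η => WithLp.toLp 2 fun X => 2 * Real.pi * Complex.I * ((η X : ℝ) : ℂ)
      map_add' := fun η η' => by
        ext X
        simp [mul_add]
      map_smul' := fun c η => by
        ext X
        simp
        ring }

@[simp]
theorem imagEmbedding_apply (η : RSpace d) (X : Fin d) :
    imagEmbedding d η X = 2 * Real.pi * Complex.I * ((η X : ℝ) : ℂ) := rfl

theorem imagEmbedding_single (X : Fin d) :
    imagEmbedding d (EuclideanSpace.single X 1) =
      (2 * Real.pi * Complex.I : ℂ) • EuclideanSpace.single X (1 : ℂ) := by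
  ext Y
  by_cases h : Y = X <;> simp [h]

/-- Derivatives at `0` of a Schwartz function that agrees near `0` with a holomorphic function on
the imaginary directions. -/
theorem iteratedLineDerivOp_eq_iteratedFDeriv_of_eventuallyEq {n : ℕ} (X : Fin n → Fin d)
    (g : 𝓢(RSpace d, ℂ)) {f : CSpace d → ℂ} (hf : AnalyticAt ℂ f 0)
    (hg : ⇑g =ᶠ[𝓝 0] fun η => f (imagEmbedding d η)) :
    (∂^{fun i => (EuclideanSpace.single (X i) (1 : ℝ) : RSpace d)} g) 0 =
      (2 * Real.pi * Complex.I : ℂ) ^ n *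
        iteratedFDeriv ℂ n f 0 fun i => EuclideanSpace.single (X i) (1 : ℂ) := by
  induction n generalizing g f with
  | zero => simp [hg.eq_of_nhds]
  | succ n ih =>
    set u : CSpace d := EuclideanSpace.single (X (Fin.last n)) (1 : ℂ)
    have hf' := analyticAt_fderiv_apply hf u
    have hc : ContDiffAt ℂ n (fderiv ℂ f) 0 := hf.fderiv.contDiffAt
    have happ := ContinuousLinearMap.iteratedFDeriv_comp_left
      (ContinuousLinearMap.apply ℂ ℂ u) hc le_rfl
    have hL : Tendsto (imagEmbedding d) (𝓝 0) (𝓝 0) := by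
      simpa using (imagEmbedding d).continuous.tendsto 0
    rw [LineDeriv.iteratedLineDerivOp_succ_right, iteratedFDeriv_succ_apply_right]
    have key : ⇑(∂_{(EuclideanSpace.single (X (Fin.last n)) (1 : ℝ) : RSpace d)} g :
        𝓢(RSpace d, ℂ)) =ᶠ[𝓝 0]
        fun η => (2 * Real.pi * Complex.I : ℂ) * fderiv ℂ f (imagEmbedding d η) u := by
      filter_upwards [hg.eventuallyEq_nhds, hL.eventually hf.eventually_analyticAt] with η h1 h2
      rw [SchwartzMap.lineDerivOp_apply_eq_fderiv, h1.fderiv_eq]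
      have := (h2.differentiableAt.hasFDerivAt.restrictScalars ℝ).comp η
        (imagEmbedding d).hasFDerivAt
      rw [show (fun η => f (imagEmbedding d η)) = f ∘ imagEmbedding d from rfl, this.fderiv]
      simp [imagEmbedding_single, u]
    have h3 := ih (fun i => X (Fin.castSucc i)) _
      (f := fun ζ => (2 * Real.pi * Complex.I : ℂ) * fderiv ℂ f ζ u)
      (analyticAt_const.fun_mul hf') key
    refine Eq.trans h3 ?_
    have h4 : iteratedFDeriv ℂ n (fun ζ => (2 * Real.pi * Complex.I : ℂ) * fderiv ℂ f ζ u) 0 =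
        (2 * Real.pi * Complex.I : ℂ) • iteratedFDeriv ℂ n (fun ζ => fderiv ℂ f ζ u) 0 := by
      rw [← iteratedFDeriv_const_smul_apply hf'.contDiffAt]
      rfl
    rw [h4, show (fun y => fderiv ℂ f y u) =
      (ContinuousLinearMap.apply ℂ ℂ u) ∘ fderiv ℂ f from rfl, happ, pow_succ]
    simp only [smul_apply, smul_eq_mul, mul_assoc]
    rfl

theorem fourier_iteratedLineDerivOp_single {n : ℕ} (X : Fin n → Fin d) (g : 𝓢(RSpace d, ℂ))
    (x : RSpace d) :
    𝓕 (∂^{fun i => (EuclideanSpace.single (X i) (1 : ℝ) : RSpace d)} g) x =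
      (2 * Real.pi * Complex.I : ℂ) ^ n * (∏ i, ((x (X i) : ℝ) : ℂ)) * 𝓕 g x := by
  induction n with
  | zero => simp
  | succ n ih =>
    have ht : (fun y : RSpace d => inner ℝ y
        (EuclideanSpace.single (X 0) (1 : ℝ))).HasTemperateGrowth := by fun_prop
    rw [LineDeriv.iteratedLineDerivOp_succ_left, SchwartzMap.fourier_lineDerivOp_eq,
      Fin.prod_univ_succ]
    have := ih (fun i => X i.succ)
    simp only [smul_apply, SchwartzMap.smulLeftCLM_apply_apply ht]
    rw [show Fin.tail (fun i => (EuclideanSpace.single (X i) (1 : ℝ) : RSpace d)) =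
      fun i : Fin n => EuclideanSpace.single (X i.succ) (1 : ℝ) from rfl, this]
    simp [EuclideanSpace.inner_single_right]
    ring

/-- The moments of `𝓕 g` are the derivatives at `0` of `g`; the powers of `2πi` cancel because `g`
is described by a holomorphic function of `2πiη`. -/
theorem integral_prod_mul_fourier {α : Type*} (X : α → Fin d) (S : Finset α)
    (g : 𝓢(RSpace d, ℂ)) {f : CSpace d → ℂ} (hf : AnalyticAt ℂ f 0)
    (hg : ⇑g =ᶠ[𝓝 0] fun η => f (imagEmbedding d η)) :
    ∫ x, (∏ a ∈ S, ((x (X a) : ℝ) : ℂ)) * 𝓕 g x =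
      setDeriv (fun a => EuclideanSpace.single (X a) (1 : ℂ)) S f 0 := by
  set e := S.equivFin.symm
  have hpi : (2 * Real.pi * Complex.I : ℂ) ≠ 0 := Complex.two_pi_I_ne_zero
  have hprod : ∀ x : RSpace d, ∏ a ∈ S, ((x (X a) : ℝ) : ℂ) =
      ∏ i, ((x (X (e i)) : ℝ) : ℂ) := by
    intro x
    rw [← Finset.prod_coe_sort, ← e.prod_comp]
  set G := ∂^{fun i => (EuclideanSpace.single (X (e i)) (1 : ℝ) : RSpace d)} g with hG
  have h1 : ∀ x, (∏ a ∈ S, ((x (X a) : ℝ) : ℂ)) * 𝓕 g x =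
      ((2 * Real.pi * Complex.I : ℂ) ^ S.card)⁻¹ * 𝓕 G x := by
    intro x
    rw [hG, fourier_iteratedLineDerivOp_single (fun i => X (e i)), hprod]
    field_simp
  have h2 : ∫ x, 𝓕 G x = G 0 := by
    have : 𝓕⁻ (𝓕 G) = G := FourierTransform.fourierInv_fourier_eq G
    conv_rhs => rw [← this, SchwartzMap.fourierInv_coe, Real.fourierInv_eq']
    simp
  simp only [h1]
  rw [integral_const_mul, h2, hG,
    iteratedLineDerivOp_eq_iteratedFDeriv_of_eventuallyEq (fun i => X (e i)) g hf hg, setDeriv]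
  field_simp
  rfl

end Moments

/-! ### Polynomial potentials and the decay of their Boltzmann factors -/

section Potential

open scoped SchwartzMap FourierTransform ContDiff

variable {d : ℕ}

theorem hasTemperateGrowth_coord (X : Fin d) :
    (fun φ : RSpace d => φ X).HasTemperateGrowth :=
  (EuclideanSpace.proj (𝕜 := ℝ) X).hasTemperateGrowth

theorem hasTemperateGrowth_prod_coord {α : Type*} (S : Finset α) (X : α → Fin d) :
    (fun φ : RSpace d => ∏ a ∈ S, φ (X a)).HasTemperateGrowth := by
  classical
  induction S using Finset.induction_on with
  | empty => simp
  | insert a S ha ih =>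
    simp only [Finset.prod_insert ha]
    exact (hasTemperateGrowth_coord (X a)).mul ih

theorem hasTemperateGrowth_homPart (lam : Tensors d) (p : ℕ) :
    (homPart lam p).HasTemperateGrowth := by
  unfold homPart
  refine Function.HasTemperateGrowth.sum fun X _ => ?_
  exact (Function.HasTemperateGrowth.const _).mul (hasTemperateGrowth_prod_coord _ _)

theorem hasTemperateGrowth_potential (lam : Tensors d) (pbar : ℕ) :
    (potential lam pbar).HasTemperateGrowth := by
  unfold potential
  exact Function.HasTemperateGrowth.sum fun p _ => hasTemperateGrowth_homPart lam p

theorem homPart_smul (lam : Tensors d) (p : ℕ) (r : ℝ) (φ : RSpace d) :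
    homPart lam p (r • φ) = r ^ p * homPart lam p φ := by
  simp only [homPart, PiLp.smul_apply, smul_eq_mul, Finset.prod_mul_distrib, Finset.prod_const,
    Finset.card_univ, Fintype.card_fin, Finset.mul_sum]
  refine Finset.sum_congr rfl fun X _ => ?_
  ring

theorem abs_homPart_le (lam : Tensors d) (p : ℕ) (φ : RSpace d) :
    |homPart lam p φ| ≤ (∑ X, |lam p X|) * ‖φ‖ ^ p := by
  rw [homPart, Finset.sum_mul]
  refine (Finset.abs_sum_le_sum_abs _ _).trans (Finset.sum_le_sum fun X _ => ?_)
  rw [abs_mul, Finset.abs_prod]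
  refine mul_le_mul_of_nonneg_left ?_ (abs_nonneg _)
  calc ∏ i, |φ (X i)| ≤ ∏ _i : Fin p, ‖φ‖ :=
        Finset.prod_le_prod (fun i _ => abs_nonneg _) fun i _ => PiLp.norm_apply_le φ (X i)
    _ = ‖φ‖ ^ p := by simp

/-- By compactness of the unit sphere, positivity of the top-degree part is quantitative. -/
theorem exists_mul_pow_le_homPart {lam : Tensors d} {pbar : ℕ}
    (hlam : IsAdmissiblePotential lam pbar) :
    ∃ c > 0, ∀ φ : RSpace d, c * ‖φ‖ ^ pbar ≤ homPart lam pbar φ := by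
  have hcont : Continuous (homPart lam pbar) :=
    (hasTemperateGrowth_homPart lam pbar).1.continuous
  have h0 : homPart lam pbar 0 = 0 := by
    have := homPart_smul lam pbar 0 (0 : RSpace d)
    simpa [hlam.pos.ne'] using this
  obtain ⟨c, hc, hmin⟩ : ∃ c > 0, ∀ φ ∈ Metric.sphere (0 : RSpace d) 1,
      c ≤ homPart lam pbar φ := by
    rcases (Metric.sphere (0 : RSpace d) 1).eq_empty_or_nonempty with h | h
    · exact ⟨1, one_pos, by simp [h]⟩
    · obtain ⟨φ, hφ, hmin⟩ := (isCompact_sphere (0 : RSpace d) 1).exists_isMinOn h hcont.continuousOn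
      refine ⟨_, hlam.top_pos φ ?_, fun ψ hψ => hmin hψ⟩
      rintro rfl
      simp at hφ
  refine ⟨c, hc, fun φ => ?_⟩
  rcases eq_or_ne φ 0 with rfl | hφ
  · simp [h0, hlam.pos.ne']
  have hn : ‖φ‖ ≠ 0 := norm_ne_zero_iff.2 hφ
  have h1 : φ = ‖φ‖ • (‖φ‖⁻¹ • φ) := by
    rw [smul_smul, mul_inv_cancel₀ hn, one_smul]
  have h2 := hmin (‖φ‖⁻¹ • φ) (by simp [norm_smul, hn])
  have h3 := homPart_smul lam pbar ‖φ‖ (‖φ‖⁻¹ • φ)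
  rw [← h1] at h3
  rw [h3, mul_comm]
  exact mul_le_mul_of_nonneg_left h2 (by positivity)

/-- The potential in the units of length in which, for `ε ^ p̄ = β`, the top-degree part of
`β * V` loses its coupling constant `β`. -/
def scaledPotential (lam : Tensors d) (pbar : ℕ) (ε : ℝ) (y : RSpace d) : ℝ :=
  ∑ p ∈ Finset.range (pbar + 1), ε ^ (pbar - p) * homPart lam p y

theorem scaledPotential_smul (lam : Tensors d) (pbar : ℕ) (ε : ℝ) (x : RSpace d) :
    scaledPotential lam pbar ε (ε • x) = ε ^ pbar * potential lam pbar x := by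
  rw [scaledPotential, potential, Finset.mul_sum]
  refine Finset.sum_congr rfl fun p hp => ?_
  rw [homPart_smul, ← mul_assoc, ← pow_add, Nat.sub_add_cancel]
  exact Nat.lt_succ_iff.1 (Finset.mem_range.1 hp)

theorem contDiff_scaledPotential (lam : Tensors d) (pbar : ℕ) (ε : ℝ) :
    ContDiff ℝ ∞ (scaledPotential lam pbar ε) := by
  unfold scaledPotential
  exact ContDiff.sum fun p _ => contDiff_const.mul (hasTemperateGrowth_homPart lam p).1

theorem exists_sub_le_mul_pow {c A : ℝ} (hc : 0 < c) {p : ℕ} (hp : 2 ≤ p) :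
    ∃ C : ℝ, ∀ r : ℝ, 0 ≤ r → r - C ≤ c * r ^ p - A * (1 + r) ^ (p - 1) := by
  have hA : (fun r : ℝ => A * (1 + r) ^ (p - 1) + r) =o[atTop] fun r : ℝ => c * r ^ p := by
    refine Asymptotics.IsLittleO.const_mul_right' hc.ne'.isUnit ?_
    refine Asymptotics.IsLittleO.add (Asymptotics.IsLittleO.const_mul_left ?_ A) ?_
    · have h1 : (fun r : ℝ => (1 + r) ^ (p - 1)) =O[atTop] fun r : ℝ => r ^ (p - 1) := by
        refine Asymptotics.IsBigO.pow ?_ _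
        refine Asymptotics.IsBigO.add ?_ (Asymptotics.isBigO_refl _ _)
        exact (Asymptotics.isLittleO_const_id_atTop (1 : ℝ)).isBigO
      exact h1.trans_isLittleO (Asymptotics.isLittleO_pow_pow_atTop_of_lt (by omega))
    · simpa using Asymptotics.isLittleO_pow_pow_atTop_of_lt (𝕜 := ℝ) (show 1 < p by omega)
  obtain ⟨R, hR⟩ := eventually_atTop.1 (hA.bound (c := 1) one_pos)
  obtain ⟨M, hM⟩ := (isCompact_Icc (a := (0 : ℝ)) (b := R)).exists_bound_of_continuousOn
    (f := fun r : ℝ => c * r ^ p - A * (1 + r) ^ (p - 1) - r)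
    (by fun_prop)
  refine ⟨max M 0, fun r hr => ?_⟩
  rcases le_total r R with h | h
  · have := hM r ⟨hr, h⟩
    rw [Real.norm_eq_abs, abs_le] at this
    linarith [le_max_left M 0]
  · have h1 := hR r h
    rw [one_mul, Real.norm_eq_abs, Real.norm_eq_abs,
      abs_of_nonneg (a := c * r ^ p) (by positivity)] at h1
    linarith [le_abs_self (A * (1 + r) ^ (p - 1) + r), le_max_right M 0]

theorem exists_norm_sub_le_scaledPotential {lam : Tensors d} {pbar : ℕ}
    (hlam : IsAdmissiblePotential lam pbar) :
    ∃ C : ℝ, ∀ ε : ℝ, 0 ≤ ε → ε ≤ 1 → ∀ y : RSpace d,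
      ‖y‖ - C ≤ scaledPotential lam pbar ε y := by
  obtain ⟨c, hc, hle⟩ := exists_mul_pow_le_homPart hlam
  have hp2 : 2 ≤ pbar := by
    have h1 := hlam.pos
    obtain ⟨k, hk⟩ := hlam.even
    omega
  set A : ℝ := ∑ p ∈ Finset.range pbar, ∑ X, |lam p X| with hA
  obtain ⟨C, hC⟩ := exists_sub_le_mul_pow (A := A) hc hp2
  refine ⟨C, fun ε h0 h1 y => (hC ‖y‖ (norm_nonneg y)).trans ?_⟩
  rw [scaledPotential, Finset.sum_range_succ, Nat.sub_self, pow_zero, one_mul]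
  have hlow : -(A * (1 + ‖y‖) ^ (pbar - 1)) ≤
      ∑ p ∈ Finset.range pbar, ε ^ (pbar - p) * homPart lam p y := by
    rw [hA, Finset.sum_mul, ← Finset.sum_neg_distrib]
    refine Finset.sum_le_sum fun p hp => ?_
    have hp := Finset.mem_range.1 hp
    have hε : ε ^ (pbar - p) ≤ 1 := pow_le_one₀ h0 h1
    have hε0 : 0 ≤ ε ^ (pbar - p) := pow_nonneg h0 _
    refine neg_le_of_abs_le ?_
    rw [abs_mul, abs_of_nonneg hε0]
    refine (mul_le_of_le_one_left (abs_nonneg _) hε).trans ((abs_homPart_le lam p y).trans ?_)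
    refine mul_le_mul_of_nonneg_left ?_ (Finset.sum_nonneg fun X _ => abs_nonneg _)
    have hy := norm_nonneg y
    calc ‖y‖ ^ p ≤ (1 + ‖y‖) ^ p := pow_le_pow_left₀ hy (by linarith) p
      _ ≤ (1 + ‖y‖) ^ (pbar - 1) := pow_le_pow_right₀ (by linarith) (by omega)
  linarith [hle y]

theorem exists_neg_le_potential {lam : Tensors d} {pbar : ℕ}
    (hlam : IsAdmissiblePotential lam pbar) :
    ∃ C : ℝ, ∀ x : RSpace d, -C ≤ potential lam pbar x := by
  obtain ⟨C, hC⟩ := exists_norm_sub_le_scaledPotential hlam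
  refine ⟨C, fun x => ?_⟩
  have h1 := hC 1 zero_le_one le_rfl x
  have h2 := scaledPotential_smul lam pbar 1 x
  simp only [one_smul, one_pow, one_mul] at h2
  rw [h2] at h1
  linarith [norm_nonneg x]

theorem exists_norm_iteratedFDeriv_scaledPotential_le (lam : Tensors d) (pbar n : ℕ) :
    ∃ (k : ℕ) (C : ℝ), 0 ≤ C ∧ ∀ ε : ℝ, 0 ≤ ε → ε ≤ 1 → ∀ i ≤ n, ∀ y : RSpace d,
      ‖iteratedFDeriv ℝ i (scaledPotential lam pbar ε) y‖ ≤ C * (1 + ‖y‖) ^ k := by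
  choose k C hC0 hC using fun p =>
    (hasTemperateGrowth_homPart lam p).norm_iteratedFDeriv_le_uniform n
  refine ⟨∑ p ∈ Finset.range (pbar + 1), k p, ∑ p ∈ Finset.range (pbar + 1), C p,
    Finset.sum_nonneg fun p _ => hC0 p, fun ε h0 h1 i hi y => ?_⟩
  have hsmooth : ∀ p, ContDiff ℝ i (homPart lam p) := fun p =>
    (hasTemperateGrowth_homPart lam p).1.of_le (mod_cast le_top)
  have hsum : iteratedFDeriv ℝ i (scaledPotential lam pbar ε) y =
      ∑ p ∈ Finset.range (pbar + 1), ε ^ (pbar - p) • iteratedFDeriv ℝ i (homPart lam p) y := by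
    have : scaledPotential lam pbar ε =
        fun y => ∑ p ∈ Finset.range (pbar + 1), ε ^ (pbar - p) • homPart lam p y := rfl
    rw [this, iteratedFDeriv_fun_sum_apply (f := fun p y => ε ^ (pbar - p) • homPart lam p y)
      fun p _ => ((hsmooth p).const_smul (ε ^ (pbar - p))).contDiffAt]
    refine Finset.sum_congr rfl fun p _ => ?_
    rw [← iteratedFDeriv_const_smul_apply (hsmooth p).contDiffAt]
    rfl
  rw [hsum, Finset.sum_mul]
  refine (norm_sum_le _ _).trans (Finset.sum_le_sum fun p hp => ?_)
  rw [norm_smul, norm_pow, Real.norm_eq_abs, abs_of_nonneg h0]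
  refine (mul_le_of_le_one_left (norm_nonneg _) (pow_le_one₀ h0 h1)).trans
    ((hC p i hi y).trans ?_)
  refine mul_le_mul_of_nonneg_left ?_ (hC0 p)
  exact pow_le_pow_right₀ (by linarith [norm_nonneg y])
    (Finset.single_le_sum (f := k) (fun _ _ => Nat.zero_le _) hp)

/-- In the scaled units the Boltzmann factors are bounded in every Schwartz seminorm, uniformly in
`ε`. -/
theorem exists_pow_mul_norm_iteratedFDeriv_exp_scaledPotential_le {lam : Tensors d} {pbar : ℕ}
    (hlam : IsAdmissiblePotential lam pbar) (n k : ℕ) :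
    ∃ C : ℝ, ∀ ε : ℝ, 0 ≤ ε → ε ≤ 1 → ∀ y : RSpace d, (1 + ‖y‖) ^ k *
      ‖iteratedFDeriv ℝ n (fun y => Real.exp (-scaledPotential lam pbar ε y)) y‖ ≤ C := by
  obtain ⟨C₀, hC₀⟩ := exists_norm_sub_le_scaledPotential hlam
  obtain ⟨l, C₁, hC₁, hl⟩ := exists_norm_iteratedFDeriv_scaledPotential_le lam pbar n
  set D : ℝ := 1 + C₁
  have hD : 1 ≤ D := by simp [D, hC₁]
  refine ⟨n.factorial * D ^ n * ((k + l * n).factorial * Real.exp (C₀ + 1)),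
    fun ε h0 h1 y => ?_⟩
  have hy : 1 ≤ 1 + ‖y‖ := by linarith [norm_nonneg y]
  have hbound := norm_iteratedFDeriv_comp_le (𝕜 := ℝ) (g := Real.exp)
    (f := fun y => -scaledPotential lam pbar ε y) (n := n) (N := ∞) Real.contDiff_exp
    (contDiff_scaledPotential lam pbar ε).neg (mod_cast le_top) y
    (C := Real.exp (-scaledPotential lam pbar ε y)) (D := D * (1 + ‖y‖) ^ l) ?_ ?_
  · have hexp : Real.exp (-scaledPotential lam pbar ε y) ≤
        Real.exp (C₀ + 1) * Real.exp (-(1 + ‖y‖)) := by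
      rw [← Real.exp_add, Real.exp_le_exp]
      linarith [hC₀ ε h0 h1 y]
    have hpow : (1 + ‖y‖) ^ (k + l * n) * Real.exp (-(1 + ‖y‖)) ≤ (k + l * n).factorial := by
      have := Real.pow_div_factorial_le_exp (1 + ‖y‖) (by linarith) (k + l * n)
      rw [div_le_iff₀ (by positivity)] at this
      rw [Real.exp_neg, mul_inv_le_iff₀ (Real.exp_pos _)]
      linarith
    calc (1 + ‖y‖) ^ k *
          ‖iteratedFDeriv ℝ n (fun y => Real.exp (-scaledPotential lam pbar ε y)) y‖
        ≤ (1 + ‖y‖) ^ k * (n.factorial * (Real.exp (C₀ + 1) * Real.exp (-(1 + ‖y‖))) *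
            (D * (1 + ‖y‖) ^ l) ^ n) := by
          refine mul_le_mul_of_nonneg_left (hbound.trans ?_) (by positivity)
          gcongr
      _ = n.factorial * D ^ n * Real.exp (C₀ + 1) *
            ((1 + ‖y‖) ^ (k + l * n) * Real.exp (-(1 + ‖y‖))) := by
          rw [pow_add, pow_mul, mul_pow]
          ring
      _ ≤ n.factorial * D ^ n * Real.exp (C₀ + 1) * (k + l * n).factorial := by
          gcongr
      _ = _ := by ring
  · intro i _
    rw [norm_iteratedFDeriv_eq_norm_iteratedDeriv, iteratedDeriv_eq_iterate, Real.iter_deriv_exp,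
      Real.norm_eq_abs, Real.abs_exp]
  · intro i hi hin
    have hneg : iteratedFDeriv ℝ i (fun y => -scaledPotential lam pbar ε y) y =
        -iteratedFDeriv ℝ i (scaledPotential lam pbar ε) y := iteratedFDeriv_neg_apply
    rw [hneg, norm_neg]
    have h2 : 1 ≤ D * (1 + ‖y‖) ^ l := one_le_mul_of_one_le_of_one_le hD (one_le_pow₀ hy)
    calc _ ≤ C₁ * (1 + ‖y‖) ^ l := hl ε h0 h1 i hin y
      _ ≤ D * (1 + ‖y‖) ^ l := by
          gcongr
          simp [D]
      _ ≤ _ := le_self_pow₀ h2 (by omega)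

/-- Bounds for the derivatives of the Boltzmann factor in the original units: every derivative
gains a power of `ε`, up to the powers lost in the weight. -/
theorem exists_pow_mul_norm_iteratedFDeriv_boltzmann_le {lam : Tensors d} {pbar : ℕ}
    (hlam : IsAdmissiblePotential lam pbar) (n k : ℕ) :
    ∃ C : ℝ, 0 ≤ C ∧ ∀ ε : ℝ, 0 < ε → ε ≤ 1 → ∀ x : RSpace d, (1 + ‖x‖) ^ k *
      ‖iteratedFDeriv ℝ n
        (fun x => ((Real.exp (-(ε ^ pbar * potential lam pbar x)) : ℝ) : ℂ)) x‖ ≤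
        C * (ε ^ n / ε ^ k) := by
  obtain ⟨C, hC⟩ := exists_pow_mul_norm_iteratedFDeriv_exp_scaledPotential_le hlam n k
  refine ⟨C, (by positivity : (0 : ℝ) ≤ _).trans (hC 0 le_rfl zero_le_one 0),
    fun ε h0 h1 x => ?_⟩
  have hsm : ContDiff ℝ ∞ (fun y : RSpace d => Real.exp (-scaledPotential lam pbar ε y)) :=
    Real.contDiff_exp.comp (contDiff_scaledPotential lam pbar ε).neg
  have hfun : (fun x => ((Real.exp (-(ε ^ pbar * potential lam pbar x)) : ℝ) : ℂ)) =
      Complex.ofRealLI ∘ fun x : RSpace d =>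
        (fun y => Real.exp (-scaledPotential lam pbar ε y)) (ε • x) := by
    ext x
    simp [scaledPotential_smul]
  have hsm' : ContDiff ℝ n (fun y : RSpace d => Real.exp (-scaledPotential lam pbar ε y)) :=
    hsm.of_le (mod_cast le_top)
  rw [hfun, LinearIsometry.norm_iteratedFDeriv_comp_left (f := fun x : RSpace d =>
    (fun y => Real.exp (-scaledPotential lam pbar ε y)) (ε • x)) _
    (hsm'.comp (contDiff_const_smul ε)).contDiffAt le_rfl, iteratedFDeriv_comp_const_smul ε hsm',
    norm_smul, norm_pow, Real.norm_eq_abs, abs_of_pos h0, mul_div_assoc', le_div_iff₀ (by positivity)]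
  have h2 : ε * (1 + ‖x‖) ≤ 1 + ‖ε • x‖ := by
    rw [norm_smul, Real.norm_eq_abs, abs_of_pos h0]
    linarith
  calc _ = ε ^ n * ((ε * (1 + ‖x‖)) ^ k * ‖iteratedFDeriv ℝ n
        (fun y => Real.exp (-scaledPotential lam pbar ε y)) (ε • x)‖) := by
          rw [mul_pow]
          ring
    _ ≤ ε ^ n * ((1 + ‖ε • x‖) ^ k * ‖iteratedFDeriv ℝ n
        (fun y => Real.exp (-scaledPotential lam pbar ε y)) (ε • x)‖) := by gcongr
    _ ≤ ε ^ n * C := by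
          gcongr
          exact hC ε h0.le h1 _
    _ = _ := mul_comm _ _

/-- The Boltzmann factor `exp (-β V)`, `β = ε ^ p̄`, as a Schwartz function. -/
def boltzmann {lam : Tensors d} {pbar : ℕ} (hlam : IsAdmissiblePotential lam pbar) {ε : ℝ}
    (h0 : 0 < ε) (h1 : ε ≤ 1) : 𝓢(RSpace d, ℂ) where
  toFun x := ((Real.exp (-(ε ^ pbar * potential lam pbar x)) : ℝ) : ℂ)
  smooth' := Complex.ofRealCLM.contDiff.comp (Real.contDiff_exp.comp
    (contDiff_const.mul (hasTemperateGrowth_potential lam pbar).1).neg)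
  decay' k n := by
    obtain ⟨C, -, hC⟩ := exists_pow_mul_norm_iteratedFDeriv_boltzmann_le hlam n k
    refine ⟨C * (ε ^ n / ε ^ k), fun x => le_trans ?_ (hC ε h0 h1 x)⟩
    gcongr
    linarith

theorem boltzmann_apply {lam : Tensors d} {pbar : ℕ} (hlam : IsAdmissiblePotential lam pbar)
    {ε : ℝ} (h0 : 0 < ε) (h1 : ε ≤ 1) (x : RSpace d) : boltzmann hlam h0 h1 x =
      ((Real.exp (-(ε ^ pbar * potential lam pbar x)) : ℝ) : ℂ) := rfl

theorem norm_pow_mul_norm_fourier_le (f : 𝓢(RSpace d, ℂ)) (n : ℕ) (η : RSpace d) :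
    ‖η‖ ^ n * ‖𝓕 f η‖ ≤ ∫ x, ‖iteratedFDeriv ℝ n f x‖ := by
  rcases eq_or_ne η 0 with rfl | hη
  · rcases Nat.eq_zero_or_pos n with rfl | hn
    · simp only [pow_zero, one_mul, norm_iteratedFDeriv_zero]
      exact VectorFourier.norm_fourierIntegral_le_integral_norm _ _ _ _ _
    · rw [norm_zero, zero_pow hn.ne', zero_mul]
      exact integral_nonneg fun x => norm_nonneg _
  have hint : ∀ m : ℕ, Integrable (iteratedFDeriv ℝ m f) := fun m =>
    haveI : SecondCountableTopologyEither (RSpace d)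
      (ContinuousMultilinearMap ℝ (fun _ : Fin m => RSpace d) ℂ) :=
      secondCountableTopologyEither_of_left _ _
    (integrable_norm_iff ((f.smooth ⊤).continuous_iteratedFDeriv
      (mod_cast le_top)).aestronglyMeasurable).1
      (by simpa using f.integrable_pow_mul_iteratedFDeriv volume 0 m)
  have h1 := congrFun (Real.fourier_iteratedFDeriv (N := ⊤) (f.smooth ⊤) (fun m _ => hint m)
    (n := n) (mod_cast le_top)) η
  have h2 : ‖𝓕 (iteratedFDeriv ℝ n f) η‖ ≤ ∫ x, ‖iteratedFDeriv ℝ n f x‖ :=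
    VectorFourier.norm_fourierIntegral_le_integral_norm _ _ _ _ _
  refine le_trans ?_ h2
  have h3 := (𝓕 (iteratedFDeriv ℝ n f) η).le_opNorm fun _ => η
  have hpi : (1 : ℝ) ≤ (2 * Real.pi) ^ n := one_le_pow₀ (by linarith [Real.pi_gt_three])
  have hηn : 0 < ‖η‖ ^ n := pow_pos (norm_pos_iff.2 hη) n
  refine le_of_mul_le_mul_right ?_ hηn
  rw [Finset.prod_const, Finset.card_univ, Fintype.card_fin] at h3
  refine le_trans ?_ h3
  rw [h1]
  have h4 : ‖(fun w => VectorFourier.fourierPowSMulRight (-innerSL ℝ) (𝓕 (f : RSpace d → ℂ)) w n) η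
      fun _ => η‖ = (2 * Real.pi) ^ n * (‖η‖ ^ n * ‖𝓕 (f : RSpace d → ℂ) η‖ * ‖η‖ ^ n) := by
    rw [VectorFourier.fourierPowSMulRight_apply]
    have h5 : innerSL ℝ η η = ‖η‖ ^ 2 := real_inner_self_eq_norm_sq η
    simp [abs_of_pos Real.pi_pos, h5]
    ring
  rw [h4]
  exact le_mul_of_one_le_left (by positivity) hpi

/-- Away from `0` the Fourier transforms of the Boltzmann factors are smaller than every power of
`ε`: the loss `ε ^ (d + 1)` does not depend on `n`. -/
theorem exists_norm_pow_mul_norm_fourier_boltzmann_le {lam : Tensors d} {pbar : ℕ}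
    (hlam : IsAdmissiblePotential lam pbar) (n : ℕ) :
    ∃ C : ℝ, 0 ≤ C ∧ ∀ (ε : ℝ) (h0 : 0 < ε) (h1 : ε ≤ 1) (η : RSpace d),
      ‖η‖ ^ n * ‖𝓕 (boltzmann hlam h0 h1) η‖ ≤ C * (ε ^ n / ε ^ (d + 1)) := by
  obtain ⟨C, hC0, hC⟩ := exists_pow_mul_norm_iteratedFDeriv_boltzmann_le hlam n (d + 1)
  have hint : Integrable (fun x : RSpace d => (1 + ‖x‖) ^ (-((d + 1 : ℕ) : ℝ))) :=
    integrable_one_add_norm (by simp)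
  refine ⟨C * ∫ x : RSpace d, (1 + ‖x‖) ^ (-((d + 1 : ℕ) : ℝ)),
    mul_nonneg hC0 (integral_nonneg fun x => by positivity), fun ε h0 h1 η => ?_⟩
  refine (norm_pow_mul_norm_fourier_le _ n η).trans ?_
  rw [mul_right_comm, ← integral_const_mul]
  refine integral_mono_of_nonneg (Eventually.of_forall fun x => norm_nonneg _)
    (hint.const_mul _) (Eventually.of_forall fun x => ?_)
  have hx : 0 < (1 + ‖x‖) ^ (d + 1) := by positivity
  have := hC ε h0 h1 x
  simp only
  rw [Real.rpow_neg (by positivity), Real.rpow_natCast, ← div_eq_mul_inv, le_div_iff₀ hx, mul_comm]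
  exact this

end Potential

/-! ### The solution as an expectation and its asymptotic expansion -/

section Expansion

open scoped SchwartzMap FourierTransform ContDiff

variable {d : ℕ}

/-- The cumulant generating function `W(ζ) = t Ψ(ζ) + ⟨ζ, ϕ⟩` of the kernel shifted by `ϕ`. -/
def cumulantFn (Ψ : CSpace d → ℂ) (t : ℝ) (ϕ : RSpace d) (ζ : CSpace d) : ℂ :=
  (t : ℂ) * Ψ ζ + ∑ X, ζ X * ((ϕ X : ℝ) : ℂ)

/-- The characteristic function `exp (W(2πiη))` of the kernel shifted by `ϕ`. -/
def charFn (Ψ : CSpace d → ℂ) (t : ℝ) (ϕ : RSpace d) (η : RSpace d) : ℂ :=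
  Complex.exp (cumulantFn Ψ t ϕ (imagEmbedding d η))

theorem cumulantFn_zero {Ψ : CSpace d → ℂ} (hΨ : IsAdmissibleSymbol Ψ) (t : ℝ) (ϕ : RSpace d) :
    cumulantFn Ψ t ϕ 0 = 0 := by
  simp [cumulantFn, hΨ.zero]

theorem analyticAt_cumulantFn {Ψ : CSpace d → ℂ} (hΨ : IsAdmissibleSymbol Ψ) (t : ℝ)
    (ϕ : RSpace d) : AnalyticAt ℂ (cumulantFn Ψ t ϕ) 0 := by
  unfold cumulantFn
  refine (analyticAt_const.fun_mul hΨ.analytic).fun_add ?_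
  refine Finset.analyticAt_fun_sum _ fun X _ => ?_
  exact ((EuclideanSpace.proj (𝕜 := ℂ) X).analyticAt 0).fun_mul analyticAt_const

theorem imagEmbedding_eq_negI (η : RSpace d) :
    imagEmbedding d η = negI (-(2 * Real.pi) • η) := by
  ext X
  simp [negI]
  ring

theorem cumulantFn_imagEmbedding (Ψ : CSpace d → ℂ) (t : ℝ) (ϕ η : RSpace d) :
    cumulantFn Ψ t ϕ (imagEmbedding d η) =
      (t : ℂ) * symbolOnReal Ψ (-(2 * Real.pi) • η) +
        2 * Real.pi * Complex.I * ((inner ℝ η ϕ : ℝ) : ℂ) := by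
  rw [cumulantFn, symbolOnReal, imagEmbedding_eq_negI]
  congr 1
  rw [← imagEmbedding_eq_negI, PiLp.inner_apply]
  push_cast
  rw [Finset.mul_sum]
  refine Finset.sum_congr rfl fun X _ => ?_
  simp
  ring

theorem contDiff_charFn {Ψ : CSpace d → ℂ} (hΨ : IsAdmissibleSymbol Ψ) (t : ℝ) (ϕ : RSpace d) :
    ContDiff ℝ ∞ (charFn Ψ t ϕ) := by
  have h : charFn Ψ t ϕ = fun η => Complex.exp ((t : ℂ) * symbolOnReal Ψ (-(2 * Real.pi) • η) +
      2 * Real.pi * Complex.I * ((inner ℝ η ϕ : ℝ) : ℂ)) := by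
    ext η
    rw [charFn, cumulantFn_imagEmbedding]
  rw [h]
  refine ContDiff.cexp (ContDiff.add (contDiff_const.mul ?_) (contDiff_const.mul ?_))
  · exact hΨ.growth.1.comp (contDiff_const_smul _)
  · exact Complex.ofRealCLM.contDiff.comp (contDiff_id.inner ℝ contDiff_const)

theorem exists_norm_charFn_le {Ψ : CSpace d → ℂ} (hΨ : IsAdmissibleSymbol Ψ) {t : ℝ}
    (ht : 0 < t) (ϕ : RSpace d) :
    ∃ (k : ℕ) (C : ℝ), 0 ≤ C ∧ ∀ η, ‖charFn Ψ t ϕ η‖ ≤ C * (1 + ‖η‖) ^ k := by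
  obtain ⟨c, hc⟩ := hΨ.re_le
  obtain ⟨k, hk⟩ := exists_nat_ge (t * c)
  refine ⟨k, (2 * Real.pi) ^ k, by positivity, fun η => ?_⟩
  have hpi : 1 ≤ 2 * Real.pi := by linarith [Real.pi_gt_three]
  rw [charFn, Complex.norm_exp, cumulantFn_imagEmbedding, Complex.add_re, Complex.re_ofReal_mul,
    show (2 * Real.pi * Complex.I * ((inner ℝ η ϕ : ℝ) : ℂ)).re = 0 by simp, add_zero, ← mul_pow]
  set r := ‖-(2 * Real.pi) • η‖ with hr
  have hr2 : r = 2 * Real.pi * ‖η‖ := by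
    rw [hr, norm_smul, norm_neg, Real.norm_eq_abs, abs_of_pos (by linarith)]
  have hr0 : 0 ≤ r := norm_nonneg _
  calc Real.exp (t * (symbolOnReal Ψ (-(2 * Real.pi) • η)).re)
      ≤ Real.exp (k * Real.log (1 + r)) := by
        refine Real.exp_le_exp.2 ?_
        calc _ ≤ t * (c * Real.log (1 + r)) := mul_le_mul_of_nonneg_left (hc _) ht.le
          _ = t * c * Real.log (1 + r) := by ring
          _ ≤ _ := mul_le_mul_of_nonneg_right hk (Real.log_nonneg (by linarith))
    _ = (1 + r) ^ k := by
        rw [← Real.log_pow, Real.exp_log (by positivity)]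
    _ ≤ _ := by
        refine pow_le_pow_left₀ (by positivity) ?_ k
        rw [hr2]
        linarith

/-- Parseval's identity: the solution pairs the characteristic function with the Fourier transform
of the Boltzmann factor. -/
theorem solution_eq_integral_charFn_mul_fourier (Ψ : CSpace d → ℂ) {lam : Tensors d} {pbar : ℕ}
    (hlam : IsAdmissiblePotential lam pbar) (t : ℝ) (ϕ : RSpace d) {ε : ℝ} (h0 : 0 < ε)
    (h1 : ε ≤ 1) :
    solution Ψ lam pbar t (ε ^ pbar) ϕ =
      ∫ η, charFn Ψ t ϕ η * 𝓕 (boltzmann hlam h0 h1) η := by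
  set f := boltzmann hlam h0 h1
  have hpi := Real.pi_pos
  have hinner : ∀ ξ : RSpace d,
      ∫ φ : RSpace d, Complex.exp (-Complex.I * ((inner ℝ ξ φ : ℝ) : ℂ)) *
        ((Real.exp (-(ε ^ pbar * potential lam pbar (ϕ - φ))) : ℝ) : ℂ) =
      Complex.exp (-Complex.I * ((inner ℝ ξ ϕ : ℝ) : ℂ)) * 𝓕 f (-(2 * Real.pi)⁻¹ • ξ) := by
    intro ξ
    rw [SchwartzMap.fourier_coe, Real.fourier_eq', ← integral_const_mul,
      ← integral_sub_left_eq_self _ volume ϕ]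
    refine integral_congr_ae (Eventually.of_forall fun x => ?_)
    simp only [smul_eq_mul, sub_sub_cancel]
    rw [← mul_assoc, ← Complex.exp_add, show f x = _ from boltzmann_apply hlam h0 h1 x]
    congr 2
    rw [inner_sub_right, inner_smul_right, real_inner_comm ξ x]
    push_cast
    field_simp
    ring
  rw [solution, kernelPairing]
  have hG : ∀ ξ : RSpace d, Complex.exp ((t : ℂ) * symbolOnReal Ψ ξ) *
      fourierInverse (fun φ => ((Real.exp (-(ε ^ pbar * potential lam pbar (ϕ - φ))) : ℝ) : ℂ)) ξ =
      (((2 * Real.pi) ^ d : ℝ) : ℂ)⁻¹ * (fun η => charFn Ψ t ϕ η * 𝓕 f η)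
        (-(2 * Real.pi)⁻¹ • ξ) := by
    intro ξ
    simp only [fourierInverse, hinner, charFn, cumulantFn_imagEmbedding]
    have h2 : -(2 * Real.pi) • -(2 * Real.pi)⁻¹ • ξ = ξ := by
      rw [smul_smul, neg_mul_neg, mul_inv_cancel₀ (by positivity), one_smul]
    have h3 : (2 * Real.pi * Complex.I * ((inner ℝ (-(2 * Real.pi)⁻¹ • ξ) ϕ : ℝ) : ℂ)) =
        -Complex.I * ((inner ℝ ξ ϕ : ℝ) : ℂ) := by
      rw [real_inner_smul_left]
      push_cast
      field_simp
    rw [h2, h3, Complex.exp_add]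
    ring
  simp only [hG]
  rw [integral_const_mul, Measure.integral_comp_smul volume
    (fun η => charFn Ψ t ϕ η * 𝓕 f η) (-(2 * Real.pi)⁻¹)]
  simp only [finrank_euclideanSpace, Fintype.card_fin]
  rw [Complex.real_smul, ← mul_assoc]
  have : |((-(2 * Real.pi)⁻¹) ^ d)⁻¹| = (2 * Real.pi) ^ d := by
    rw [abs_inv, abs_pow, abs_neg, abs_inv, abs_of_pos (by positivity : 0 < 2 * Real.pi), inv_pow,
      inv_inv]
  rw [this, inv_mul_cancel₀ (by exact_mod_cast (by positivity : (2 * Real.pi) ^ d ≠ 0)), one_mul]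

/-- Only the behaviour of the characteristic function near `0` matters, up to every power of `ε`:
the Fourier transforms of the Boltzmann factors concentrate at `0`. -/
theorem exists_norm_integral_sub_le {K : RSpace d → ℂ} (hK : Continuous K) {k : ℕ} {A : ℝ}
    (hA : 0 ≤ A) (hKA : ∀ η, ‖K η‖ ≤ A * (1 + ‖η‖) ^ k) (g : 𝓢(RSpace d, ℂ))
    (hg1 : ∀ η, ‖η‖ ≤ 1 → g η = K η) (hg : ∀ η, ‖K η - g η‖ ≤ ‖K η‖) {lam : Tensors d} {pbar : ℕ}
    (hlam : IsAdmissiblePotential lam pbar) (M : ℕ) :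
    ∃ C : ℝ, 0 ≤ C ∧ ∀ (ε : ℝ) (h0 : 0 < ε) (h1 : ε ≤ 1),
      ‖(∫ η, K η * 𝓕 (boltzmann hlam h0 h1) η) - ∫ η, g η * 𝓕 (boltzmann hlam h0 h1) η‖ ≤
        C * ε ^ M := by
  obtain ⟨C, hC0, hC⟩ := exists_norm_pow_mul_norm_fourier_boltzmann_le hlam (k + (d + 1) + M)
  have hint : Integrable (fun x : RSpace d => (1 + ‖x‖) ^ (-((d + 1 : ℕ) : ℝ))) :=
    integrable_one_add_norm (by simp)
  set B := A * 2 ^ (k + (d + 1)) * C with hB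
  have hB0 : 0 ≤ B := by positivity
  refine ⟨B * ∫ x : RSpace d, (1 + ‖x‖) ^ (-((d + 1 : ℕ) : ℝ)),
    mul_nonneg hB0 (integral_nonneg fun x => by positivity), fun ε h0 h1 => ?_⟩
  set f := boltzmann hlam h0 h1
  have hbound : ∀ η, ‖(K η - g η) * 𝓕 f η‖ ≤
      B * ε ^ M * (1 + ‖η‖) ^ (-((d + 1 : ℕ) : ℝ)) := by
    intro η
    rcases le_or_gt ‖η‖ 1 with h | h
    · rw [hg1 η h, sub_self, zero_mul, norm_zero]
      positivity
    · have hη : 0 < 1 + ‖η‖ := by positivity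
      rw [Real.rpow_neg hη.le, Real.rpow_natCast, ← div_eq_mul_inv, le_div_iff₀ (by positivity),
        norm_mul]
      have hε : ε ^ (k + (d + 1) + M) / ε ^ (d + 1) ≤ ε ^ M := by
        rw [div_le_iff₀ (by positivity), ← pow_add]
        exact pow_le_pow_of_le_one h0.le h1 (by omega)
      calc ‖K η - g η‖ * ‖𝓕 f η‖ * (1 + ‖η‖) ^ (d + 1)
          ≤ A * (1 + ‖η‖) ^ k * ‖𝓕 f η‖ * (1 + ‖η‖) ^ (d + 1) := by
            gcongr
            exact (hg η).trans (hKA η)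
        _ = A * (1 + ‖η‖) ^ (k + (d + 1)) * ‖𝓕 f η‖ := by
            rw [pow_add]
            ring
        _ ≤ A * (2 * ‖η‖) ^ (k + (d + 1)) * ‖𝓕 f η‖ := by
            gcongr
            linarith
        _ = A * 2 ^ (k + (d + 1)) * (‖η‖ ^ (k + (d + 1)) * ‖𝓕 f η‖) := by
            rw [mul_pow]
            ring
        _ ≤ A * 2 ^ (k + (d + 1)) * (‖η‖ ^ (k + (d + 1) + M) * ‖𝓕 f η‖) := by
            gcongr ?_ * (?_ * ?_)
            exact pow_le_pow_right₀ h.le (by omega)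
        _ ≤ A * 2 ^ (k + (d + 1)) * (C * ε ^ M) := by
            exact mul_le_mul_of_nonneg_left ((hC ε h0 h1 η).trans
              (mul_le_mul_of_nonneg_left hε hC0)) (by positivity)
        _ = B * ε ^ M := by rw [hB]; ring
  have hdiff : Integrable fun η => (K η - g η) * 𝓕 f η := by
    refine (hint.const_mul (B * ε ^ M)).mono' ?_ (Eventually.of_forall hbound)
    exact ((hK.sub g.continuous).mul (𝓕 f).continuous).aestronglyMeasurable
  have hgint : Integrable fun η => g η * 𝓕 f η := by
    refine (SchwartzMap.smulLeftCLM ℂ (g : RSpace d → ℂ) (𝓕 f))|>.integrable (μ := volume) |>.congr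
      (Eventually.of_forall fun η => ?_)
    simp [SchwartzMap.smulLeftCLM_apply_apply g.hasTemperateGrowth]
  have hKint : Integrable fun η => K η * 𝓕 f η := by
    refine (hdiff.add hgint).congr (Eventually.of_forall fun η => ?_)
    simp only [Pi.add_apply]
    ring
  rw [← integral_sub hKint hgint]
  simp only [← sub_mul]
  refine (norm_integral_le_of_norm_le (hint.const_mul (B * ε ^ M))
    (Eventually.of_forall hbound)).trans (le_of_eq ?_)
  rw [integral_const_mul]
  ring

/-- Taylor's formula for `exp (-y)` with a remainder that is uniform on half-lines bounded below. -/
theorem exists_abs_exp_neg_sub_sum_le (N : ℕ) (A : ℝ) :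
    ∃ C : ℝ, 0 ≤ C ∧ ∀ y : ℝ, -A ≤ y →
      |Real.exp (-y) - ∑ m ∈ Finset.range (N + 1), (-y) ^ m / m.factorial| ≤
        C * |y| ^ (N + 1) := by
  refine ⟨Real.exp (max A 1) + (1 + ∑ m ∈ Finset.range (N + 1), (1 : ℝ) / m.factorial),
    by positivity, fun y hy => ?_⟩
  have hS : (0 : ℝ) ≤ 1 + ∑ m ∈ Finset.range (N + 1), (1 : ℝ) / m.factorial := by positivity
  rcases le_or_gt y 1 with h | h
  · have hy' : |y| ≤ max A 1 := abs_le.2 ⟨by linarith [le_max_left A 1],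
      h.trans (le_max_right _ _)⟩
    have := Complex.norm_exp_sub_sum_le_norm_mul_exp ((-y : ℝ) : ℂ) (N + 1)
    have e : Complex.exp ((-y : ℝ) : ℂ) -
        ∑ m ∈ Finset.range (N + 1), ((-y : ℝ) : ℂ) ^ m / m.factorial =
        ((Real.exp (-y) - ∑ m ∈ Finset.range (N + 1), (-y) ^ m / m.factorial : ℝ) : ℂ) := by
      push_cast
      rfl
    rw [e, Complex.norm_real, Complex.norm_real, Real.norm_eq_abs, Real.norm_eq_abs, abs_neg]
      at this
    refine this.trans ?_
    rw [mul_comm]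
    refine mul_le_mul_of_nonneg_right ?_ (by positivity)
    linarith [Real.exp_le_exp.2 hy']
  · have h0 : 0 < y := by linarith
    rw [abs_of_pos h0]
    have hy1 : 1 ≤ y ^ (N + 1) := one_le_pow₀ h.le
    have h1 : |Real.exp (-y)| ≤ y ^ (N + 1) := by
      rw [Real.abs_exp]
      exact (Real.exp_le_one_iff.2 (by linarith)).trans hy1
    have h2 : |∑ m ∈ Finset.range (N + 1), (-y) ^ m / m.factorial| ≤
        (∑ m ∈ Finset.range (N + 1), (1 : ℝ) / m.factorial) * y ^ (N + 1) := by
      rw [Finset.sum_mul]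
      refine (Finset.abs_sum_le_sum_abs _ _).trans (Finset.sum_le_sum fun m hm => ?_)
      rw [abs_div, abs_pow, abs_neg, abs_of_pos h0, Nat.abs_cast, div_mul_eq_mul_div, one_mul]
      gcongr
      · exact h.le
      · exact (Finset.mem_range.1 hm).le
    calc _ ≤ |Real.exp (-y)| + _ := abs_sub _ _
      _ ≤ y ^ (N + 1) + (∑ m ∈ Finset.range (N + 1), (1 : ℝ) / m.factorial) * y ^ (N + 1) :=
          add_le_add h1 h2
      _ = (1 + ∑ m ∈ Finset.range (N + 1), (1 : ℝ) / m.factorial) * y ^ (N + 1) := by ring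
      _ ≤ _ := by
          refine mul_le_mul_of_nonneg_right ?_ (by positivity)
          linarith [Real.exp_pos (max A 1)]

theorem integrable_mul_schwartz {q : RSpace d → ℝ} (hq : q.HasTemperateGrowth)
    (ρ : 𝓢(RSpace d, ℂ)) : Integrable fun x => ((q x : ℝ) : ℂ) * ρ x := by
  have hq' : (fun x => ((q x : ℝ) : ℂ)).HasTemperateGrowth :=
    by fun_prop
  refine (SchwartzMap.smulLeftCLM ℂ (fun x => ((q x : ℝ) : ℂ)) ρ)|>.integrable (μ := volume) |>.congr
    (Eventually.of_forall fun x => ?_)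
  simp [SchwartzMap.smulLeftCLM_apply_apply hq']

/-- Expansion of an expectation `∫ exp (-β V) ρ` with respect to a Schwartz density. -/
theorem exists_norm_integral_exp_sub_sum_le (ρ : 𝓢(RSpace d, ℂ)) {lam : Tensors d} {pbar : ℕ}
    (hlam : IsAdmissiblePotential lam pbar) (N : ℕ) :
    ∃ C : ℝ, 0 ≤ C ∧ ∀ β : ℝ, 0 < β → β ≤ 1 →
      ‖(∫ x, ((Real.exp (-(β * potential lam pbar x)) : ℝ) : ℂ) * ρ x) -
        ∑ m ∈ Finset.range (N + 1), (-(β : ℂ)) ^ m / m.factorial *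
          ∫ x, ((potential lam pbar x ^ m : ℝ) : ℂ) * ρ x‖ ≤ C * β ^ (N + 1) := by
  set V := potential lam pbar with hV
  have hVt : V.HasTemperateGrowth := hasTemperateGrowth_potential lam pbar
  obtain ⟨A, hA⟩ := exists_neg_le_potential hlam
  obtain ⟨C, hC0, hC⟩ := exists_abs_exp_neg_sub_sum_le N (max A 0)
  have hpow : ∀ m : ℕ, Integrable fun x => ((V x ^ m : ℝ) : ℂ) * ρ x := fun m =>
    integrable_mul_schwartz (hVt.pow m) ρ
  refine ⟨C * ∫ x, ‖((V x ^ (N + 1) : ℝ) : ℂ) * ρ x‖,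
    mul_nonneg hC0 (integral_nonneg fun x => norm_nonneg _), fun β h0 h1 => ?_⟩
  have hlow : ∀ x, -max A 0 ≤ β * V x := by
    intro x
    have h2 := hA x
    have h3 : 0 ≤ max A 0 := le_max_right _ _
    have h4 : -max A 0 ≤ V x := by linarith [le_max_left A 0]
    nlinarith
  have hbound : ∀ x, ‖((Real.exp (-(β * V x)) : ℝ) : ℂ) * ρ x -
      ∑ m ∈ Finset.range (N + 1), (-(β : ℂ)) ^ m / m.factorial * (((V x ^ m : ℝ) : ℂ) * ρ x)‖ ≤
      C * β ^ (N + 1) * ‖((V x ^ (N + 1) : ℝ) : ℂ) * ρ x‖ := by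
    intro x
    have e : ((Real.exp (-(β * V x)) : ℝ) : ℂ) * ρ x -
      ∑ m ∈ Finset.range (N + 1), (-(β : ℂ)) ^ m / m.factorial * (((V x ^ m : ℝ) : ℂ) * ρ x) =
      ((Real.exp (-(β * V x)) -
        ∑ m ∈ Finset.range (N + 1), (-(β * V x)) ^ m / m.factorial : ℝ) : ℂ) * ρ x := by
      push_cast
      rw [sub_mul, Finset.sum_mul]
      congr 1
      refine Finset.sum_congr rfl fun m _ => ?_
      rw [← neg_mul, mul_pow]
      ring
    rw [e, norm_mul, norm_mul, Complex.norm_real, Complex.norm_real, Real.norm_eq_abs, ← mul_assoc]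
    refine mul_le_mul_of_nonneg_right ((hC _ (hlow x)).trans (le_of_eq ?_)) (norm_nonneg _)
    rw [abs_mul, abs_of_pos h0, mul_pow, Real.norm_eq_abs, abs_pow, mul_assoc]
  have hsum : Integrable fun x => ∑ m ∈ Finset.range (N + 1),
      (-(β : ℂ)) ^ m / m.factorial * (((V x ^ m : ℝ) : ℂ) * ρ x) :=
    integrable_finsetSum _ fun m _ => (hpow m).const_mul _
  have hVc : Continuous V := hVt.1.continuous
  have hdiff : Integrable fun x => ((Real.exp (-(β * V x)) : ℝ) : ℂ) * ρ x -
      ∑ m ∈ Finset.range (N + 1), (-(β : ℂ)) ^ m / m.factorial * (((V x ^ m : ℝ) : ℂ) * ρ x) := by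
    refine ((hpow (N + 1)).norm.const_mul (C * β ^ (N + 1))).mono' ?_ (Eventually.of_forall hbound)
    have hρ := ρ.continuous
    exact Continuous.aestronglyMeasurable (by fun_prop)
  have hexp : Integrable fun x => ((Real.exp (-(β * V x)) : ℝ) : ℂ) * ρ x := by
    refine (hdiff.add hsum).congr (Eventually.of_forall fun x => ?_)
    simp
  have hint : ∑ m ∈ Finset.range (N + 1), (-(β : ℂ)) ^ m / m.factorial *
      ∫ x, ((V x ^ m : ℝ) : ℂ) * ρ x = ∫ x, ∑ m ∈ Finset.range (N + 1),
      (-(β : ℂ)) ^ m / m.factorial * (((V x ^ m : ℝ) : ℂ) * ρ x) := by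
    rw [integral_finsetSum _ fun m _ => (hpow m).const_mul _]
    simp only [integral_const_mul]
  rw [hint, ← integral_sub hexp hsum]
  refine (norm_integral_le_of_norm_le ((hpow (N + 1)).norm.const_mul (C * β ^ (N + 1)))
    (Eventually.of_forall hbound)).trans (le_of_eq ?_)
  rw [integral_const_mul]
  ring

/-- A Schwartz density whose expectations have the solution's asymptotic expansion and whose
moments are those of the kernel shifted by `ϕ`. It is the Fourier transform of the characteristic
function cut off smoothly outside a neighbourhood of `0`. -/
theorem exists_density {Ψ : CSpace d → ℂ} (hΨ : IsAdmissibleSymbol Ψ) {lam : Tensors d}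
    {pbar : ℕ} (hlam : IsAdmissiblePotential lam pbar) {t : ℝ} (ht : 0 < t) (ϕ : RSpace d) :
    ∃ ρ : 𝓢(RSpace d, ℂ),
      (∀ (α : Type) [DecidableEq α] (X : α → Fin d) (S : Finset α),
        ∫ x, (∏ a ∈ S, ((x (X a) : ℝ) : ℂ)) * ρ x = partitionSum (fun B =>
          setDeriv (fun a => EuclideanSpace.single (X a) (1 : ℂ)) B (cumulantFn Ψ t ϕ) 0) S) ∧
      ∀ N : ℕ, ∃ C : ℝ, ∀ β : ℝ, 0 < β → β ≤ 1 →
        ‖solution Ψ lam pbar t β ϕ - ∑ m ∈ Finset.range (N + 1), (-(β : ℂ)) ^ m / m.factorial *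
          ∫ x, ((potential lam pbar x ^ m : ℝ) : ℂ) * ρ x‖ ≤ C * β ^ (N + 1) := by
  set K := charFn Ψ t ϕ with hK
  have hKs : ContDiff ℝ ∞ K := contDiff_charFn hΨ t ϕ
  obtain ⟨k, A, hA, hKA⟩ := exists_norm_charFn_le hΨ ht ϕ
  let χ : ContDiffBump (0 : RSpace d) := ⟨1, 2, one_pos, one_lt_two⟩
  have hχs : ContDiff ℝ ∞ fun η => ((χ η : ℝ) : ℂ) * K η :=
    (Complex.ofRealCLM.contDiff.comp χ.contDiff).mul hKs
  have hχc : HasCompactSupport fun η => ((χ η : ℝ) : ℂ) * K η :=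
    (χ.hasCompactSupport.comp_left (g := fun r : ℝ => (r : ℂ)) (by simp)).mul_right
  let g : 𝓢(RSpace d, ℂ) := hχc.toSchwartzMap hχs
  have hgχ : ∀ η, g η = ((χ η : ℝ) : ℂ) * K η := fun η => rfl
  have hg1 : ∀ η, ‖η‖ ≤ 1 → g η = K η := by
    intro η hη
    rw [hgχ, χ.one_of_mem_closedBall (by simpa using hη)]
    simp
  have hg2 : ∀ η, ‖K η - g η‖ ≤ ‖K η‖ := by
    intro η
    have : K η - g η = ((1 - χ η : ℝ) : ℂ) * K η := by
      rw [hgχ]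
      push_cast
      ring
    rw [this, norm_mul, Complex.norm_real, Real.norm_eq_abs,
      abs_of_nonneg (sub_nonneg.2 χ.le_one)]
    exact mul_le_of_le_one_left (norm_nonneg _) (by linarith [χ.nonneg (x := η)])
  have hg0 : ⇑g =ᶠ[𝓝 0] fun η => Complex.exp (cumulantFn Ψ t ϕ (imagEmbedding d η)) := by
    filter_upwards [Metric.closedBall_mem_nhds (0 : RSpace d) one_pos] with η hη
    rw [hg1 η (by simpa using hη)]
    rfl
  have hW := analyticAt_cumulantFn hΨ t ϕ
  refine ⟨𝓕 g, fun α _ X S => ?_, fun N => ?_⟩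
  · rw [integral_prod_mul_fourier X S g (f := fun ζ => Complex.exp (cumulantFn Ψ t ϕ ζ)) hW.cexp
      hg0, setDeriv_exp _ S hW, cumulantFn_zero hΨ, Complex.exp_zero, mul_one]
  · obtain ⟨C₁, hC₁, h₁⟩ := exists_norm_integral_sub_le hKs.continuous hA hKA g hg1 hg2 hlam
      (pbar * (N + 1))
    obtain ⟨C₂, hC₂, h₂⟩ := exists_norm_integral_exp_sub_sum_le (𝓕 g) hlam N
    refine ⟨C₁ + C₂, fun β h0 h1 => ?_⟩
    -- The cutoff error is `O(ε ^ (p̄ (N + 1)))`, which is `O(β ^ (N + 1))`.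
    set ε : ℝ := β ^ ((pbar : ℝ)⁻¹) with hε
    have hε0 : 0 < ε := Real.rpow_pos_of_pos h0 _
    have hε1 : ε ≤ 1 := Real.rpow_le_one h0.le h1 (by positivity)
    have hεβ : ε ^ pbar = β := Real.rpow_inv_natCast_pow h0.le hlam.pos.ne'
    have h3 := h₁ ε hε0 hε1
    rw [← solution_eq_integral_charFn_mul_fourier, pow_mul, hεβ,
      ← SchwartzMap.integral_fourier_mul_eq] at h3
    have h4 := h₂ β h0 h1
    have h5 : ∫ x, 𝓕 g x * boltzmann hlam hε0 hε1 x =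
        ∫ x, ((Real.exp (-(β * potential lam pbar x)) : ℝ) : ℂ) * 𝓕 g x := by
      refine integral_congr_ae (Eventually.of_forall fun x => ?_)
      simp only [boltzmann_apply, hεβ]
      rw [mul_comm]
    rw [h5] at h3
    refine (norm_sub_le_norm_sub_add_norm_sub _ _ _).trans ((add_le_add h3 h4).trans (le_of_eq ?_))
    ring

end Expansion

/-! ### Joint cumulants -/

section Cumulants

theorem prod_update_eq_mul_prod_erase {ι R : Type*} [DecidableEq ι] [CommRing R] (f : ι → R)
    {S : Finset ι} {j : ι} (hj : j ∈ S) (x : R) :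
    ∏ i ∈ S, Function.update f j x i = x * ∏ i ∈ S.erase j, f i := by
  rw [← Finset.mul_prod_erase S _ hj, Function.update_self]
  congr 1
  refine Finset.prod_congr rfl fun i hi => ?_
  rw [Function.update_of_ne (Finset.ne_of_mem_erase hi)]

theorem prod_update_of_notMem_index {ι R : Type*} [DecidableEq ι] [CommRing R] (f : ι → R)
    {S : Finset ι} {j : ι} (hj : j ∉ S) (x : R) :
    ∏ i ∈ S, Function.update f j x i = ∏ i ∈ S, f i := by
  refine Finset.prod_congr rfl fun i hi => ?_
  rw [Function.update_of_ne]
  rintro rfl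
  exact hj hi

variable {ι R : Type*} [LinearOrder ι] [CommRing R] [Algebra ℝ R]

/-- The joint cumulant of `f j`, `j ∈ S`, under the expectation `E`, defined from the moments by
splitting off the cluster that contains the least element of `S`. -/
def jointCumulant (E : R →ₗ[ℝ] ℂ) (f : ι → R) (S : Finset ι) : ℂ :=
  if h : S.Nonempty then
    E (∏ j ∈ S, f j) - ∑ T ∈ (S.powerset.filter fun T => S.min' h ∈ T ∧ T ≠ S).attach,
      jointCumulant E f T * E (∏ j ∈ S \ T, f j)
  else 0
termination_by S.card
decreasing_by
  have hT := (Finset.mem_filter.1 T.2)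
  exact Finset.card_lt_card (Finset.ssubset_iff_subset_ne.2
    ⟨Finset.mem_powerset.1 hT.1, hT.2.2⟩)

theorem jointCumulant_eq (E : R →ₗ[ℝ] ℂ) (f : ι → R) {S : Finset ι} (h : S.Nonempty) :
    jointCumulant E f S = E (∏ j ∈ S, f j) -
      ∑ T ∈ S.powerset.filter fun T => S.min' h ∈ T ∧ T ≠ S,
        jointCumulant E f T * E (∏ j ∈ S \ T, f j) := by
  rw [jointCumulant, dif_pos h]
  congr 1
  exact Finset.sum_attach _ fun T => jointCumulant E f T * E (∏ j ∈ S \ T, f j)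

theorem ssubset_of_mem_filter {S T : Finset ι} {s : ι}
    (hT : T ∈ S.powerset.filter fun T => s ∈ T ∧ T ≠ S) : T ⊂ S ∧ s ∈ T := by
  rw [Finset.mem_filter, Finset.mem_powerset] at hT
  exact ⟨Finset.ssubset_iff_subset_ne.2 ⟨hT.1, hT.2.2⟩, hT.2.1⟩

/-- The moment recursion determines the cumulants. -/
theorem eq_jointCumulant {E : R →ₗ[ℝ] ℂ} (hE : E 1 = 1) {f : ι → R} {C : Finset ι → ℂ}
    (hC : ∀ (S : Finset ι) (s : ι), s ∈ S → E (∏ j ∈ S, f j) =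
      ∑ T ∈ S.powerset.filter (s ∈ ·), C T * E (∏ j ∈ S \ T, f j))
    {S : Finset ι} (hS : S.Nonempty) : C S = jointCumulant E f S := by
  induction S using Finset.strongInduction with
  | H S ih =>
    rw [jointCumulant_eq E f hS, hC S _ (S.min'_mem hS)]
    have hsplit : S.powerset.filter (S.min' hS ∈ ·) =
        insert S (S.powerset.filter fun T => S.min' hS ∈ T ∧ T ≠ S) := by
      ext T
      simp only [Finset.mem_filter, Finset.mem_powerset, Finset.mem_insert]
      constructor
      · rintro ⟨h1, h2⟩
        by_cases h : T = S
        · exact Or.inl h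
        · exact Or.inr ⟨h1, h2, h⟩
      · rintro (rfl | ⟨h1, h2, -⟩)
        · exact ⟨subset_rfl, T.min'_mem hS⟩
        · exact ⟨h1, h2⟩
    rw [hsplit, Finset.sum_insert (by simp)]
    have : ∀ T ∈ S.powerset.filter fun T => S.min' hS ∈ T ∧ T ≠ S,
        jointCumulant E f T * E (∏ j ∈ S \ T, f j) = C T * E (∏ j ∈ S \ T, f j) := by
      intro T hT
      obtain ⟨h1, h2⟩ := ssubset_of_mem_filter hT
      rw [ih T h1 ⟨_, h2⟩]
    rw [Finset.sum_congr rfl this]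
    simp [hE]

theorem jointCumulant_congr (E : R →ₗ[ℝ] ℂ) {f g : ι → R} {S : Finset ι}
    (h : ∀ j ∈ S, f j = g j) : jointCumulant E f S = jointCumulant E g S := by
  induction S using Finset.strongInduction with
  | H S ih =>
    rcases S.eq_empty_or_nonempty with rfl | hS
    · rw [jointCumulant, jointCumulant]
      simp
    rw [jointCumulant_eq E f hS, jointCumulant_eq E g hS, Finset.prod_congr rfl h]
    congr 1
    refine Finset.sum_congr rfl fun T hT => ?_
    obtain ⟨h1, h2⟩ := ssubset_of_mem_filter hT
    rw [ih T h1 fun j hj => h j (h1.1 hj),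
      Finset.prod_congr rfl fun j hj => h j (Finset.mem_sdiff.1 hj).1]

/-- Joint cumulants are linear in each argument. -/
theorem jointCumulant_update_add_smul (E : R →ₗ[ℝ] ℂ) (f : ι → R) {S : Finset ι} {j : ι}
    (hj : j ∈ S) (c : ℝ) (x y : R) :
    jointCumulant E (Function.update f j (x + c • y)) S =
      jointCumulant E (Function.update f j x) S +
        c * jointCumulant E (Function.update f j y) S := by
  induction S using Finset.strongInduction with
  | H S ih =>
    have hS : S.Nonempty := ⟨j, hj⟩
    have hlin : ∀ T : Finset ι, j ∈ T → E (∏ i ∈ T, Function.update f j (x + c • y) i) =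
        E (∏ i ∈ T, Function.update f j x i) + c * E (∏ i ∈ T, Function.update f j y i) := by
      intro T hT
      rw [prod_update_eq_mul_prod_erase f hT, prod_update_eq_mul_prod_erase f hT,
        prod_update_eq_mul_prod_erase f hT, add_mul, smul_mul_assoc, map_add, map_smul,
        Complex.real_smul]
    rw [jointCumulant_eq E _ hS, jointCumulant_eq E _ hS, jointCumulant_eq E _ hS, hlin S hj,
      mul_sub, Finset.mul_sum, sub_add_sub_comm, ← Finset.sum_add_distrib]
    congr 1
    refine Finset.sum_congr rfl fun T hT => ?_
    obtain ⟨h1, h2⟩ := ssubset_of_mem_filter hT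
    by_cases hjT : j ∈ T
    · have hn : j ∉ S \ T := fun h => (Finset.mem_sdiff.1 h).2 hjT
      rw [ih T h1 hjT, prod_update_of_notMem_index f hn, prod_update_of_notMem_index f hn,
        prod_update_of_notMem_index f hn]
      ring
    · have hcongr : ∀ z, jointCumulant E (Function.update f j z) T = jointCumulant E f T := by
        intro z
        refine jointCumulant_congr E fun i hi => Function.update_of_ne ?_ _ _
        rintro rfl
        exact hjT hi
      rw [hcongr, hcongr, hcongr, hlin _ (Finset.mem_sdiff.2 ⟨hj, hjT⟩)]
      ring

/-- The joint cumulant of a finite family as a multilinear map. -/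
def cumulantMultilinear [Fintype ι] (E : R →ₗ[ℝ] ℂ) : MultilinearMap ℝ (fun _ : ι => R) ℂ where
  toFun f := jointCumulant E f Finset.univ
  map_update_add' := by
    intro hdec f j x y
    obtain rfl := Subsingleton.elim hdec (LinearOrder.toDecidableEq : DecidableEq ι)
    simpa using jointCumulant_update_add_smul E f (Finset.mem_univ j) 1 x y
  map_update_smul' := by
    intro hdec f j c x
    obtain rfl := Subsingleton.elim hdec (LinearOrder.toDecidableEq : DecidableEq ι)
    have h0 : jointCumulant E (Function.update f j 0) Finset.univ = 0 := by
      simpa using jointCumulant_update_add_smul E f (Finset.mem_univ j) 1 0 0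
    simpa [h0] using jointCumulant_update_add_smul E f (Finset.mem_univ j) c 0 x

/-- The cumulants of a sequence of moments. -/
def cumulantSeq (a : ℕ → ℂ) : ℕ → ℂ
  | 0 => 0
  | n + 1 => a (n + 1) - ∑ j : Fin n, (n.choose j : ℂ) * cumulantSeq a (j + 1) * a (n - j)

/-- The moment-cumulant recursion, that is, the differential equation of the exponential of the
generating function of the cumulants. -/
theorem moment_succ_eq_sum {a : ℕ → ℂ} (ha : a 0 = 1) (n : ℕ) :
    a (n + 1) = ∑ j ∈ Finset.range (n + 1),
      (n.choose j : ℂ) * cumulantSeq a (j + 1) * a (n - j) := by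
  rw [Finset.sum_range_succ, Finset.sum_range]
  simp only [Nat.choose_self, Nat.sub_self, ha, Nat.cast_one, one_mul, mul_one]
  rw [cumulantSeq]
  ring

/-- The joint cumulants of identical arguments. -/
theorem jointCumulant_const {E : R →ₗ[ℝ] ℂ} (hE : E 1 = 1) (V : R) {S : Finset ι}
    (hS : S.Nonempty) :
    jointCumulant E (fun _ => V) S = cumulantSeq (fun m => E (V ^ m)) S.card := by
  refine (eq_jointCumulant hE (C := fun S => cumulantSeq (fun m => E (V ^ m)) S.card)
    (fun S s hs => ?_) hS).symm
  obtain ⟨S, hs', rfl⟩ : ∃ S', s ∉ S' ∧ insert s S' = S :=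
    ⟨S.erase s, Finset.notMem_erase s S, Finset.insert_erase hs⟩
  have hfilter : (insert s S).powerset.filter (s ∈ ·) = S.powerset.image (insert s) := by
    ext T
    simp only [Finset.mem_filter, Finset.mem_powerset, Finset.mem_image]
    constructor
    · rintro ⟨h1, h2⟩
      refine ⟨T.erase s, ?_, Finset.insert_erase h2⟩
      exact (Finset.erase_subset_erase s h1).trans_eq (Finset.erase_insert hs')
    · rintro ⟨U, hU, rfl⟩
      exact ⟨Finset.insert_subset_insert s hU, Finset.mem_insert_self s U⟩
  rw [hfilter, Finset.sum_image]
  · have hterm : ∀ U ∈ S.powerset,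
        cumulantSeq (fun m => E (V ^ m)) (insert s U).card * E (∏ _j ∈ insert s S \ insert s U, V) =
        cumulantSeq (fun m => E (V ^ m)) (U.card + 1) * E (V ^ (S.card - U.card)) := by
      intro U hU
      have hU := Finset.mem_powerset.1 hU
      have hsU : s ∉ U := fun h => hs' (hU h)
      rw [Finset.prod_const, Finset.card_sdiff_of_subset (Finset.insert_subset_insert s hU),
        Finset.card_insert_of_notMem hsU, Finset.card_insert_of_notMem hs', Nat.add_sub_add_right]
    rw [Finset.sum_congr rfl hterm, Finset.sum_powerset_apply_card
      (fun n => cumulantSeq (fun m => E (V ^ m)) (n + 1) * E (V ^ (S.card - n))),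
      Finset.prod_const, Finset.card_insert_of_notMem hs',
      moment_succ_eq_sum (a := fun m => E (V ^ m)) (by simpa using hE)]
    refine Finset.sum_congr rfl fun j _ => ?_
    rw [nsmul_eq_mul, mul_assoc]
  · intro U hU U' hU' h
    simp only [Finset.coe_powerset, Set.mem_preimage, Set.mem_powerset_iff, Finset.coe_subset]
      at hU hU'
    rw [← Finset.erase_insert fun h' => hs' (hU h'), h, Finset.erase_insert fun h' => hs' (hU' h')]

end Cumulants

/-! ### The logarithm of an asymptotic series -/

section Logarithm

/-- The Taylor coefficients of the exponential of a generating function of cumulants are the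
moments. -/
theorem iteratedDeriv_exp_cumulants {a : ℕ → ℂ} (ha : a 0 = 1) (N : ℕ) {q : ℂ → ℂ}
    (hq : Differentiable ℂ q) (hqa : ∀ j ≤ N, iteratedDeriv j q 0 = cumulantSeq a j) {n : ℕ}
    (hn : n ≤ N) : iteratedDeriv n (fun z => Complex.exp (q z)) 0 = a n := by
  induction n using Nat.strong_induction_on with
  | h n ih =>
    rcases n with _ | n
    · have h0 := hqa 0 (Nat.zero_le N)
      rw [iteratedDeriv_zero] at h0
      simp only [iteratedDeriv_zero, h0, ha, cumulantSeq, Complex.exp_zero]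
    · have hder : deriv (fun z => Complex.exp (q z)) =
          fun z => deriv q z * Complex.exp (q z) := by
        ext z
        rw [deriv_cexp hq.differentiableAt, mul_comm]
      have hd : ContDiff ℂ n (deriv q) := hq.deriv.contDiff
      rw [iteratedDeriv_succ', hder, iteratedDeriv_fun_mul hd.contDiffAt
        hq.contDiff.cexp.contDiffAt, moment_succ_eq_sum ha]
      refine Finset.sum_congr rfl fun j hj => ?_
      have hj := Finset.mem_range.1 hj
      rw [← iteratedDeriv_succ', hqa (j + 1) (by omega), ih (n - j) (by omega) (by omega)]

/-- The exponential turns the truncated cumulant series into the truncated moment series, up to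
terms of higher order. -/
theorem exp_cumulants_isBigO {a : ℕ → ℂ} (ha : a 0 = 1) (N : ℕ) :
    (fun z : ℂ => Complex.exp (∑ m ∈ Finset.range (N + 1), z ^ m / m.factorial * cumulantSeq a m) -
      ∑ m ∈ Finset.range (N + 1), z ^ m / m.factorial * a m) =O[𝓝 0] fun z => ‖z‖ ^ (N + 1) := by
  set q : ℂ → ℂ := fun z => ∑ m ∈ Finset.range (N + 1), z ^ m / m.factorial * cumulantSeq a m
    with hq
  have hqd : Differentiable ℂ q := by fun_prop
  have hqa : ∀ j ≤ N, iteratedDeriv j q 0 = cumulantSeq a j := by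
    intro j hj
    rw [hq, iteratedDeriv_fun_sum fun m _ => by fun_prop]
    simp only [iteratedDeriv_mul_const_field, div_eq_mul_inv, iteratedDeriv_fun_pow_zero]
    rw [Finset.sum_eq_single j]
    · have : (j.factorial : ℂ) ≠ 0 := by exact_mod_cast j.factorial_ne_zero
      simp [this]
    · intro m _ hm
      simp [Ne.symm hm]
    · intro h
      exact absurd (Finset.mem_range.2 (by omega)) h
  have han : AnalyticAt ℂ (fun z => Complex.exp (q z)) 0 :=
    hqd.cexp.analyticAt 0
  have h := han.hasFPowerSeriesAt.isBigO_sub_partialSum_pow (N + 1)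
  refine h.congr_left fun z => ?_
  rw [zero_add, FormalMultilinearSeries.partialSum]
  congr 1
  refine Finset.sum_congr rfl fun m hm => ?_
  rw [FormalMultilinearSeries.ofScalars_apply_eq,
    iteratedDeriv_exp_cumulants ha N hqd hqa (Nat.lt_succ_iff.1 (Finset.mem_range.1 hm)),
    smul_eq_mul]
  ring

theorem tendsto_one_of_moments {a : ℕ → ℂ} (ha : a 0 = 1) {F : ℝ → ℂ}
    (hF : (fun β : ℝ => F β - ∑ m ∈ Finset.range (0 + 1),
      (-(β : ℂ)) ^ m / m.factorial * a m) =O[𝓝[>] 0] fun β : ℝ => β ^ (0 + 1)) :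
    Tendsto F (𝓝[>] 0) (𝓝 1) := by
  have h1 : Tendsto (fun β : ℝ => β ^ (0 + 1)) (𝓝[>] 0) (𝓝 0) := by
    have : Tendsto (fun β : ℝ => β) (𝓝[>] 0) (𝓝 0) := tendsto_id.mono_left nhdsWithin_le_nhds
    simpa using this
  have h2 := (hF.trans_tendsto h1).add_const 1
  simpa [ha] using h2

/-- If the moments `a` give an asymptotic expansion of `F`, their cumulants give one of `log F`. -/
theorem log_isBigO_of_moments {a : ℕ → ℂ} (ha : a 0 = 1) {F : ℝ → ℂ}
    (hF : ∀ N : ℕ, (fun β : ℝ => F β - ∑ m ∈ Finset.range (N + 1),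
      (-(β : ℂ)) ^ m / m.factorial * a m) =O[𝓝[>] 0] fun β : ℝ => β ^ (N + 1)) (N : ℕ) :
    (fun β : ℝ => Complex.log (F β) - ∑ m ∈ Finset.range (N + 1),
      (-(β : ℂ)) ^ m / m.factorial * cumulantSeq a m) =O[𝓝[>] 0] fun β : ℝ => β ^ (N + 1) := by
  set q : ℂ → ℂ := fun z => ∑ m ∈ Finset.range (N + 1), z ^ m / m.factorial * cumulantSeq a m
    with hq
  have hqc : Continuous q := by fun_prop
  have hq0 : q 0 = 0 := by
    refine Finset.sum_eq_zero fun m _ => ?_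
    rcases m with _ | m
    · rw [cumulantSeq, mul_zero]
    · simp
  have hneg : Tendsto (fun β : ℝ => -(β : ℂ)) (𝓝[>] 0) (𝓝 0) := by
    have : Continuous fun β : ℝ => -(β : ℂ) := by fun_prop
    simpa using (this.tendsto 0).mono_left nhdsWithin_le_nhds
  have hqt : Tendsto (fun β : ℝ => q (-(β : ℂ))) (𝓝[>] 0) (𝓝 0) := by
    have := (hqc.tendsto 0).comp hneg
    rwa [hq0] at this
  have hexp1 : Tendsto (fun β : ℝ => Complex.exp (q (-(β : ℂ)))) (𝓝[>] 0) (𝓝 1) := by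
    simpa using hqt.cexp
  have hexp : (fun β : ℝ => Complex.exp (q (-(β : ℂ))) - ∑ m ∈ Finset.range (N + 1),
      (-(β : ℂ)) ^ m / m.factorial * a m) =O[𝓝[>] 0] fun β : ℝ => β ^ (N + 1) := by
    have h := (exp_cumulants_isBigO ha N).comp_tendsto hneg
    refine h.trans (Asymptotics.IsBigO.of_bound 1 (Eventually.of_forall fun β => ?_))
    simp
  have hsub : (fun β : ℝ => F β - Complex.exp (q (-(β : ℂ)))) =O[𝓝[>] 0]
      fun β : ℝ => β ^ (N + 1) := by
    refine ((hF N).sub hexp).congr_left fun β => ?_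
    ring
  have hlog : HasStrictFDerivAt Complex.log _ 1 :=
    (Complex.hasStrictDerivAt_log (x := 1) (by simp)).hasStrictFDerivAt
  have hF1 := tendsto_one_of_moments ha (hF 0)
  have h := hlog.isBigO_sub.comp_tendsto (hF1.prodMk_nhds hexp1)
  refine (h.trans hsub).congr' ?_ (Eventually.of_forall fun _ => rfl)
  -- Near `β = 0` the exponent is small, so that the principal logarithm recovers it.
  have him : ∀ᶠ β : ℝ in 𝓝[>] 0, ‖q (-(β : ℂ))‖ < Real.pi := by
    have := hqt.norm
    rw [norm_zero] at this
    exact this.eventually_lt_const Real.pi_pos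
  filter_upwards [him] with β hβ
  have h1 := abs_lt.1 ((Complex.abs_im_le_norm _).trans_lt hβ)
  simp only [Function.comp_apply]
  rw [Complex.log_exp h1.1 h1.2.le]

end Logarithm

/-! ### Feynman graphs as partitions of the legs with marked singletons -/

theorem exists_equiv_of_range_eq {α β γ : Type*} {f : α → γ} {g : β → γ}
    (hf : Function.Injective f) (hg : Function.Injective g) (h : Set.range f = Set.range g) :
    ∃ σ : α ≃ β, ∀ a, g (σ a) = f a := by
  refine ⟨(Equiv.ofInjective f hf).trans ((Equiv.setCongr h).trans (Equiv.ofInjective g hg).symm),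
    fun a => ?_⟩
  have := Equiv.apply_ofInjective_symm hg (Equiv.setCongr h (Equiv.ofInjective f hf a))
  simpa using this

namespace LabelledGraph

variable {m : ℕ} {p : Fin m → ℕ}

@[simp]
theorem mem_legsAt {G : LabelledGraph p} {u : Fin G.inner ⊕ Fin G.outer} {a : Legs p} :
    a ∈ G.legsAt u ↔ G.target a = u := by
  simp [legsAt]

theorem legsAt_nonempty (G : LabelledGraph p) (u : Fin G.inner ⊕ Fin G.outer) :
    (G.legsAt u).Nonempty := by
  rcases u with v | w
  · obtain ⟨a, ha⟩ := G.inner_met v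
    exact ⟨a, mem_legsAt.2 ha⟩
  · obtain ⟨a, ha, -⟩ := G.outer_met w
    exact ⟨a, mem_legsAt.2 ha⟩

theorem legsAt_injective (G : LabelledGraph p) : Function.Injective G.legsAt := by
  intro u u' h
  obtain ⟨a, ha⟩ := G.legsAt_nonempty u
  have ha' := ha
  rw [h] at ha'
  rw [mem_legsAt] at ha ha'
  rw [← ha, ha']

/-- The blocks of the legs that run into a common empty vertex. -/
def blocks (G : LabelledGraph p) : Finset (Finset (Legs p)) :=
  Finset.univ.image G.legsAt

/-- The blocks that belong to the outer empty vertices. -/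
def outerBlocks (G : LabelledGraph p) : Finset (Finset (Legs p)) :=
  Finset.univ.image fun w => G.legsAt (Sum.inr w)

theorem legsAt_mem_blocks (G : LabelledGraph p) (u : Fin G.inner ⊕ Fin G.outer) :
    G.legsAt u ∈ G.blocks :=
  Finset.mem_image_of_mem _ (Finset.mem_univ u)

theorem isSetPartition_blocks (G : LabelledGraph p) : IsSetPartition G.blocks Finset.univ := by
  refine ⟨?_, fun B _ => Finset.subset_univ B, fun a _ => ⟨G.legsAt (G.target a),
    ⟨G.legsAt_mem_blocks _, mem_legsAt.2 rfl⟩, ?_⟩⟩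
  · intro h
    obtain ⟨u, -, hu⟩ := Finset.mem_image.1 h
    exact (G.legsAt_nonempty u).ne_empty hu
  · rintro B ⟨hB, ha⟩
    obtain ⟨u, -, rfl⟩ := Finset.mem_image.1 hB
    rw [mem_legsAt.1 ha]

theorem outerBlocks_subset (G : LabelledGraph p) : G.outerBlocks ⊆ G.blocks := by
  intro B hB
  obtain ⟨w, -, rfl⟩ := Finset.mem_image.1 hB
  exact G.legsAt_mem_blocks _

theorem card_eq_one_of_mem_outerBlocks (G : LabelledGraph p) {B : Finset (Legs p)}
    (hB : B ∈ G.outerBlocks) : B.card = 1 := by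
  obtain ⟨w, -, rfl⟩ := Finset.mem_image.1 hB
  obtain ⟨a, ha, hu⟩ := G.outer_met w
  rw [Finset.card_eq_one]
  refine ⟨a, Finset.ext fun b => ?_⟩
  rw [mem_legsAt, Finset.mem_singleton]
  exact ⟨hu b, fun h => h ▸ ha⟩

theorem blocks_sdiff_outerBlocks (G : LabelledGraph p) :
    G.blocks \ G.outerBlocks = Finset.univ.image fun v => G.legsAt (Sum.inl v) := by
  ext B
  simp only [Finset.mem_sdiff, blocks, outerBlocks, Finset.mem_image, Finset.mem_univ, true_and]
  constructor
  · rintro ⟨⟨v | w, rfl⟩, h⟩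
    · exact ⟨v, rfl⟩
    · exact absurd ⟨w, rfl⟩ h
  · rintro ⟨v, rfl⟩
    refine ⟨⟨_, rfl⟩, ?_⟩
    rintro ⟨w, hw⟩
    exact Sum.inr_ne_inl (G.legsAt_injective hw)

theorem blocks_eq_of_relabel {G H : LabelledGraph p} (h : G.Relabel H) :
    G.blocks = H.blocks ∧ G.outerBlocks = H.outerBlocks := by
  obtain ⟨σ, τ, h⟩ := h
  have hl := legsAt_relabel σ τ h
  constructor
  · ext B
    simp only [blocks, Finset.mem_image, Finset.mem_univ, true_and]
    rw [← (Equiv.sumCongr σ τ).exists_congr_right]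
    simp only [hl]
  · ext B
    simp only [outerBlocks, Finset.mem_image, Finset.mem_univ, true_and]
    rw [← τ.exists_congr_right]
    refine exists_congr fun w => ?_
    rw [← hl (Sum.inr w)]
    rfl

/-- The blocks determine a graph up to the names of its empty vertices. -/
theorem relabel_of_blocks_eq {G H : LabelledGraph p} (h : G.blocks = H.blocks)
    (ho : G.outerBlocks = H.outerBlocks) : G.Relabel H := by
  have hi : G.blocks \ G.outerBlocks = H.blocks \ H.outerBlocks := by rw [h, ho]
  rw [blocks_sdiff_outerBlocks, blocks_sdiff_outerBlocks] at hi
  obtain ⟨σ, hσ⟩ := exists_equiv_of_range_eq (f := fun v => G.legsAt (Sum.inl v))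
    (g := fun v => H.legsAt (Sum.inl v)) (G.legsAt_injective.comp Sum.inl_injective)
    (H.legsAt_injective.comp Sum.inl_injective)
    (by simpa only [Finset.coe_image, Finset.coe_univ, Set.image_univ] using Finset.coe_inj.2 hi)
  obtain ⟨τ, hτ⟩ := exists_equiv_of_range_eq (f := fun w => G.legsAt (Sum.inr w))
    (g := fun w => H.legsAt (Sum.inr w)) (G.legsAt_injective.comp Sum.inr_injective)
    (H.legsAt_injective.comp Sum.inr_injective)
    (by simpa only [outerBlocks, Finset.coe_image, Finset.coe_univ, Set.image_univ] using
      Finset.coe_inj.2 ho)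
  refine ⟨σ, τ, fun a => ?_⟩
  have ha : a ∈ G.legsAt (G.target a) := mem_legsAt.2 rfl
  rw [← mem_legsAt]
  rcases hu : G.target a with v | w
  · rw [hu] at ha
    have := hσ v
    rw [← this] at ha
    exact ha
  · rw [hu] at ha
    have := hτ w
    rw [← this] at ha
    exact ha

/-- Every partition of the legs with marked singletons comes from a graph. -/
theorem exists_blocks_eq {P O : Finset (Finset (Legs p))} (hP : IsSetPartition P Finset.univ)
    (hO : O ⊆ P) (hO1 : ∀ B ∈ O, B.card = 1) :
    ∃ G : LabelledGraph p, G.blocks = P ∧ G.outerBlocks = O := by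
  classical
  choose b hb hbu using fun a => hP.2.2 a (Finset.mem_univ a)
  have hmem : ∀ a B, B ∈ P → (b a = B ↔ a ∈ B) := fun a B hB =>
    ⟨fun h => h ▸ (hb a).2, fun h => (hbu a B ⟨hB, h⟩).symm⟩
  let target : Legs p → Fin (P \ O).card ⊕ Fin O.card := fun a =>
    if h : b a ∈ O then Sum.inr (O.equivFin ⟨b a, h⟩)
    else Sum.inl ((P \ O).equivFin ⟨b a, Finset.mem_sdiff.2 ⟨(hb a).1, h⟩⟩)
  have hinl : ∀ a v, target a = Sum.inl v ↔ b a = (P \ O).equivFin.symm v := by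
    intro a v
    simp only [target]
    split_ifs with h
    · simp only [false_iff]
      intro he
      exact (Finset.mem_sdiff.1 ((P \ O).equivFin.symm v).2).2 (he ▸ h)
    · rw [Sum.inl.injEq, ← Equiv.eq_symm_apply, Subtype.ext_iff]
  have hinr : ∀ a w, target a = Sum.inr w ↔ b a = O.equivFin.symm w := by
    intro a w
    simp only [target]
    split_ifs with h
    · rw [Sum.inr.injEq, ← Equiv.eq_symm_apply, Subtype.ext_iff]
    · simp only [false_iff]
      intro he
      exact h (he ▸ (O.equivFin.symm w).2)
  have hin : ∀ v, (((P \ O).equivFin.symm v : Finset (Legs p))) ∈ P := fun v =>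
    (Finset.mem_sdiff.1 ((P \ O).equivFin.symm v).2).1
  have hout : ∀ w, ((O.equivFin.symm w : Finset (Legs p))) ∈ P := fun w =>
    hO (O.equivFin.symm w).2
  let G : LabelledGraph p :=
    { inner := (P \ O).card
      outer := O.card
      target := target
      inner_met := fun v => by
        obtain ⟨a, ha⟩ := hP.nonempty (hin v)
        exact ⟨a, (hinl a v).2 ((hmem _ _ (hin v)).2 ha)⟩
      outer_met := fun w => by
        obtain ⟨a, ha⟩ := Finset.card_eq_one.1 (hO1 _ (O.equivFin.symm w).2)
        refine ⟨a, (hinr a w).2 ((hmem _ _ (hout w)).2 (by simp [ha])), fun c hc => ?_⟩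
        have := (hmem _ _ (hout w)).1 ((hinr c w).1 hc)
        rwa [ha, Finset.mem_singleton] at this }
  have hl : ∀ v, G.legsAt (Sum.inl v) = (P \ O).equivFin.symm v := by
    intro v
    ext a
    rw [mem_legsAt, ← hmem a _ (hin v)]
    exact hinl a v
  have hr : ∀ w, G.legsAt (Sum.inr w) = O.equivFin.symm w := by
    intro w
    ext a
    rw [mem_legsAt, ← hmem a _ (hout w)]
    exact hinr a w
  have houter : G.outerBlocks = O := by
    ext B
    simp only [outerBlocks, Finset.mem_image, Finset.mem_univ, true_and, hr]
    constructor
    · rintro ⟨w, rfl⟩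
      exact (O.equivFin.symm w).2
    · intro hB
      exact ⟨O.equivFin ⟨B, hB⟩, by simp⟩
  refine ⟨G, ?_, houter⟩
  have hinner : G.blocks \ G.outerBlocks = P \ O := by
    rw [blocks_sdiff_outerBlocks]
    ext B
    simp only [Finset.mem_image, Finset.mem_univ, true_and, hl]
    constructor
    · rintro ⟨v, rfl⟩
      exact ((P \ O).equivFin.symm v).2
    · intro hB
      exact ⟨(P \ O).equivFin ⟨B, hB⟩, by simp⟩
  rw [← Finset.sdiff_union_of_subset G.outerBlocks_subset, hinner, houter,
    Finset.sdiff_union_of_subset hO]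

theorem adj_iff {G : LabelledGraph p} {x y : Fin m ⊕ (Fin G.inner ⊕ Fin G.outer)} :
    G.toSimpleGraph.Adj x y ↔ ∃ a : Legs p,
      (x = Sum.inl a.1 ∧ y = Sum.inr (G.target a)) ∨
      (y = Sum.inl a.1 ∧ x = Sum.inr (G.target a)) := by
  simp only [toSimpleGraph, SimpleGraph.fromRel_adj]
  constructor
  · rintro ⟨-, ⟨a, h⟩ | ⟨a, h⟩⟩
    · exact ⟨a, Or.inl h⟩
    · exact ⟨a, Or.inr h⟩
  · rintro ⟨a, h | h⟩
    · exact ⟨by rw [h.1, h.2]; simp, Or.inl ⟨a, h⟩⟩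
    · exact ⟨by rw [h.1, h.2]; simp, Or.inr ⟨a, h⟩⟩

/-- A graph is connected exactly if its blocks connect the full vertices: every empty vertex is met
by an edge. -/
theorem isConnected_iff (G : LabelledGraph p) :
    G.IsConnected ↔ IsConnectedOn (Sigma.fst : Legs p → Fin m) G.blocks Finset.univ := by
  have hadj : ∀ a : Legs p,
      G.toSimpleGraph.Adj (Sum.inl a.1) (Sum.inr (G.target a)) := fun a =>
    adj_iff.2 ⟨a, Or.inl ⟨rfl, rfl⟩⟩
  constructor
  · intro hG
    refine ⟨?_, fun T _ hT hTc => ?_⟩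
    · obtain ⟨x⟩ := hG.nonempty
      rcases x with j | u
      · exact ⟨j, Finset.mem_univ j⟩
      · obtain ⟨a, -⟩ := G.legsAt_nonempty u
        exact ⟨a.1, Finset.mem_univ _⟩
    · -- The vertices in `T`, with the empty vertices joined to them, are closed under adjacency.
      let U : Set (Fin m ⊕ (Fin G.inner ⊕ Fin G.outer)) :=
        {x | Sum.elim (fun j => j ∈ T) (fun u => G.legsAt u ⊆ fiber Sigma.fst T) x}
      have hU : ∀ a : Legs p,
          (Sum.inl a.1 ∈ U ↔ (Sum.inr (G.target a) : Fin m ⊕ _) ∈ U) := by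
        intro a
        change a.1 ∈ T ↔ G.legsAt (G.target a) ⊆ fiber Sigma.fst T
        have ha : a ∈ G.legsAt (G.target a) := mem_legsAt.2 rfl
        constructor
        · intro haT
          refine (hTc _ (G.legsAt_mem_blocks _)).resolve_right fun hd => ?_
          exact Finset.disjoint_left.1 hd ha (mem_fiber.2 haT)
        · exact fun h => mem_fiber.1 (h ha)
      have hstep : ∀ x y, G.toSimpleGraph.Adj x y → x ∈ U → y ∈ U := by
        intro x y hxy hx
        obtain ⟨a, ⟨rfl, rfl⟩ | ⟨rfl, rfl⟩⟩ := adj_iff.1 hxy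
        · exact (hU a).1 hx
        · exact (hU a).2 hx
      have hwalk : ∀ x y, G.toSimpleGraph.Walk x y → x ∈ U → y ∈ U := by
        intro x y w
        induction w with
        | nil => exact id
        | cons h _ ih => exact fun hx => ih (hstep _ _ h hx)
      obtain ⟨j, hj⟩ := hT
      refine Finset.eq_univ_of_forall fun i => ?_
      obtain ⟨w⟩ := hG.preconnected (Sum.inl j) (Sum.inl i)
      exact hwalk _ _ w hj
  · rintro ⟨⟨j, -⟩, hconn⟩
    classical
    let T : Finset (Fin m) :=
      Finset.univ.filter fun i => G.toSimpleGraph.Reachable (Sum.inl j) (Sum.inl i)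
    have hTc : IsClosedUnder Sigma.fst G.blocks T := by
      intro B hB
      obtain ⟨u, -, rfl⟩ := Finset.mem_image.1 hB
      rw [or_iff_not_imp_right, Finset.not_disjoint_iff]
      rintro ⟨a, ha, haT⟩ c hc
      rw [mem_legsAt] at ha hc
      have h1 : G.toSimpleGraph.Reachable (Sum.inl j) (Sum.inl a.1) := by
        simpa [T] using haT
      have h2 := (h1.trans (hadj a).reachable)
      have h3 := (hadj c).symm.reachable
      rw [ha] at h2
      rw [hc] at h3
      simpa [T] using h2.trans h3
    have hT := hconn T (Finset.subset_univ _) ⟨j, by simp [T]⟩ hTc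
    have hall : ∀ x, G.toSimpleGraph.Reachable (Sum.inl j) x := by
      have hl : ∀ i, G.toSimpleGraph.Reachable (Sum.inl j) (Sum.inl i) := by
        intro i
        have : i ∈ T := by rw [hT]; exact Finset.mem_univ i
        simpa [T] using this
      rintro (i | u)
      · exact hl i
      · obtain ⟨a, ha⟩ := G.legsAt_nonempty u
        rw [mem_legsAt] at ha
        exact ha ▸ (hl a.1).trans (hadj a).reachable
    have : Nonempty (Fin m ⊕ (Fin G.inner ⊕ Fin G.outer)) := ⟨Sum.inl j⟩
    exact ⟨fun x y => (hall x).symm.trans (hall y)⟩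

/-- The weight of a block that belongs to an outer empty vertex. -/
def outerWeight {d : ℕ} (ϕ : RSpace d) (X : Legs p → Fin d) (B : Finset (Legs p)) : ℂ :=
  if B.card = 1 then ∏ a ∈ B, ((ϕ (X a) : ℝ) : ℂ) else 0

theorem value_eq_sum_prod_blocks {d : ℕ} (Ψ : CSpace d → ℂ) (lam : Tensors d) (t : ℝ)
    (ϕ : RSpace d) (G : LabelledGraph p) :
    G.value Ψ lam t ϕ = ∑ X : Legs p → Fin d,
      (∏ j : Fin m, ((lam (p j) fun i => X ⟨j, i⟩ : ℝ) : ℂ)) *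
        ((∏ B ∈ G.outerBlocks, outerWeight ϕ X B) *
          ∏ B ∈ G.blocks \ G.outerBlocks, ((t : ℂ) * setCoeff Ψ X B)) := by
  rw [value]
  refine Finset.sum_congr rfl fun X _ => ?_
  rw [blocks_sdiff_outerBlocks, mul_assoc]
  congr 2
  · rw [outerBlocks, Finset.prod_image fun w _ w' _ h =>
      Sum.inr_injective (G.legsAt_injective h)]
    refine Finset.prod_congr rfl fun w _ => ?_
    rw [outerWeight, if_pos]
    exact G.card_eq_one_of_mem_outerBlocks (Finset.mem_image_of_mem _ (Finset.mem_univ w))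
  · rw [Finset.prod_image fun v _ v' _ h => Sum.inl_injective (G.legsAt_injective h)]

end LabelledGraph

namespace FeynmanGraph

variable {m : ℕ} {p : Fin m → ℕ}

/-- The partition of the legs and the blocks of the outer empty vertices of a Feynman graph. -/
def blockPair (G : FeynmanGraph p) : Finset (Finset (Legs p)) × Finset (Finset (Legs p)) :=
  Quotient.lift (fun G : LabelledGraph p => (G.blocks, G.outerBlocks))
    (fun _ _ h => Prod.ext (LabelledGraph.blocks_eq_of_relabel h).1
      (LabelledGraph.blocks_eq_of_relabel h).2) G

open scoped Classical in
/-- Connected Feynman graphs are connected partitions of the legs with some singletons marked. -/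
theorem sum_isConnected_eq [Fintype {G : FeynmanGraph p // G.IsConnected}]
    (F : Finset (Finset (Legs p)) → Finset (Finset (Legs p)) → ℂ) :
    ∑ G : {G : FeynmanGraph p // G.IsConnected}, F G.1.blockPair.1 G.1.blockPair.2 =
      ∑ P ∈ (setPartitions (Finset.univ : Finset (Legs p))).filter
          (fun P => IsConnectedOn Sigma.fst P Finset.univ),
        ∑ O ∈ P.powerset.filter (fun O => ∀ B ∈ O, B.card = 1), F P O := by
  rw [Finset.sum_sigma']
  refine Finset.sum_bij (fun G _ => ⟨G.1.blockPair.1, G.1.blockPair.2⟩) ?_ ?_ ?_ ?_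
  · rintro ⟨G, hG⟩ -
    induction G using Quotient.inductionOn with
    | h G =>
      simp only [Finset.mem_sigma, Finset.mem_filter, mem_setPartitions, Finset.mem_powerset]
      exact ⟨⟨G.isSetPartition_blocks, G.isConnected_iff.1 hG⟩, G.outerBlocks_subset,
        fun B hB => G.card_eq_one_of_mem_outerBlocks hB⟩
  · rintro ⟨G, hG⟩ - ⟨H, hH⟩ - h
    induction G using Quotient.inductionOn with
    | h G =>
    induction H using Quotient.inductionOn with
    | h H =>
      simp only [Sigma.mk.injEq, heq_eq_eq] at h
      exact Subtype.ext (Quotient.sound (LabelledGraph.relabel_of_blocks_eq h.1 h.2))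
  · rintro ⟨P, O⟩ hPO
    simp only [Finset.mem_sigma, Finset.mem_filter, mem_setPartitions, Finset.mem_powerset] at hPO
    obtain ⟨⟨hP, hPc⟩, hO, hO1⟩ := hPO
    obtain ⟨G, rfl, rfl⟩ := LabelledGraph.exists_blocks_eq hP hO hO1
    exact ⟨⟨Quotient.mk _ G, G.isConnected_iff.2 hPc⟩, Finset.mem_univ _, rfl⟩
  · intro G _
    rfl

/-- The values of the connected graphs with given leg numbers: summing over the marked singletons
adds the two weights of a singleton. -/
theorem sum_value_eq_sum_connectedSum [Fintype {G : FeynmanGraph p // G.IsConnected}] {d : ℕ}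
    (Ψ : CSpace d → ℂ) (lam : Tensors d) (t : ℝ) (ϕ : RSpace d) :
    ∑ G : {G : FeynmanGraph p // G.IsConnected}, G.1.value Ψ lam t ϕ =
      ∑ X : Legs p → Fin d, (∏ j : Fin m, ((lam (p j) fun i => X ⟨j, i⟩ : ℝ) : ℂ)) *
        connectedSum (Sigma.fst : Legs p → Fin m) (fun B =>
          LabelledGraph.outerWeight ϕ X B + (t : ℂ) * LabelledGraph.setCoeff Ψ X B)
          Finset.univ := by
  classical
  have hval : ∀ G : {G : FeynmanGraph p // G.IsConnected}, G.1.value Ψ lam t ϕ =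
      ∑ X : Legs p → Fin d, (∏ j : Fin m, ((lam (p j) fun i => X ⟨j, i⟩ : ℝ) : ℂ)) *
        ((∏ B ∈ G.1.blockPair.2, LabelledGraph.outerWeight ϕ X B) *
          ∏ B ∈ G.1.blockPair.1 \ G.1.blockPair.2,
            ((t : ℂ) * LabelledGraph.setCoeff Ψ X B)) := by
    rintro ⟨G, hG⟩
    induction G using Quotient.inductionOn with
    | h G => exact G.value_eq_sum_prod_blocks Ψ lam t ϕ
  simp only [hval]
  rw [Finset.sum_comm]
  refine Finset.sum_congr rfl fun X _ => ?_
  rw [← Finset.mul_sum, sum_isConnected_eq fun P O =>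
    (∏ B ∈ O, LabelledGraph.outerWeight ϕ X B) *
      ∏ B ∈ P \ O, ((t : ℂ) * LabelledGraph.setCoeff Ψ X B), connectedSum]
  have huniv : fiber (Sigma.fst : Legs p → Fin m) Finset.univ = Finset.univ := by
    ext a
    simp
  rw [huniv]
  congr 1
  refine Finset.sum_congr (by congr) fun P _ => ?_
  -- Expanding the product chooses the set `O` of outer blocks; it contributes only if all of them are
  -- singletons.
  rw [Finset.prod_add, Finset.sum_filter]
  refine Finset.sum_congr rfl fun O _ => ?_
  split_ifs with h
  · rfl
  · push Not at h
    obtain ⟨B, hB, hB1⟩ := h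
    rw [Finset.prod_eq_zero hB (by rw [LabelledGraph.outerWeight, if_neg hB1]), zero_mul]

end FeynmanGraph

/-! ### The weights of the blocks -/

theorem setDeriv_zero_fun {E α : Type*} [NormedAddCommGroup E] [NormedSpace ℂ E] (v : α → E)
    (S : Finset α) (x : E) : setDeriv v S (fun _ => (0 : ℂ)) x = 0 := by
  rw [setDeriv, iteratedFDeriv_fun_zero]
  rfl

theorem setDeriv_const_mul {E α : Type*} [NormedAddCommGroup E] [NormedSpace ℂ E] (v : α → E)
    (S : Finset α) (c : ℂ) {f : E → ℂ} {x : E} (hf : AnalyticAt ℂ f x) :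
    setDeriv v S (fun y => c * f y) x = c * setDeriv v S f x := by
  have h : iteratedFDeriv ℂ S.card (fun y => c * f y) x = c • iteratedFDeriv ℂ S.card f x := by
    rw [← iteratedFDeriv_const_smul_apply hf.contDiffAt]
    rfl
  rw [setDeriv, setDeriv, h]
  rfl

/-- A linear function only has first derivatives. -/
theorem setDeriv_clm {E α : Type*} [NormedAddCommGroup E] [NormedSpace ℂ E] [DecidableEq α]
    (v : α → E) {S : Finset α} (hS : S.Nonempty) (L : E →L[ℂ] ℂ) :
    setDeriv v S L 0 = if S.card = 1 then ∏ a ∈ S, L (v a) else 0 := by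
  obtain ⟨a, ha⟩ := hS
  obtain ⟨S, ha', rfl⟩ : ∃ S', a ∉ S' ∧ insert a S' = S :=
    ⟨S.erase a, Finset.notMem_erase a S, Finset.insert_erase ha⟩
  rw [setDeriv_insert (L.analyticAt 0) ha']
  simp only [ContinuousLinearMap.fderiv]
  rcases S.eq_empty_or_nonempty with rfl | ⟨b, hb⟩
  · rw [setDeriv_empty]
    simp
  · obtain ⟨S, hb', rfl⟩ : ∃ S', b ∉ S' ∧ insert b S' = S :=
      ⟨S.erase b, Finset.notMem_erase b S, Finset.insert_erase hb⟩
    rw [setDeriv_insert analyticAt_const hb', if_neg]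
    · simp only [fderiv_fun_const, Pi.zero_apply, zero_apply]
      exact setDeriv_zero_fun v S 0
    · rw [Finset.card_insert_of_notMem ha', Finset.card_insert_of_notMem hb']
      omega

/-- The cumulants of the kernel shifted by `ϕ`: an inner empty vertex contributes `t C_B`, an outer
one contributes the shift, which only affects the first cumulants. -/
theorem setDeriv_cumulantFn {d m : ℕ} {p : Fin m → ℕ} {Ψ : CSpace d → ℂ}
    (hΨ : IsAdmissibleSymbol Ψ) (t : ℝ) (ϕ : RSpace d) (X : Legs p → Fin d)
    {B : Finset (Legs p)} (hB : B.Nonempty) :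
    setDeriv (fun a => EuclideanSpace.single (X a) (1 : ℂ)) B (cumulantFn Ψ t ϕ) 0 =
      LabelledGraph.outerWeight ϕ X B + (t : ℂ) * LabelledGraph.setCoeff Ψ X B := by
  let L : CSpace d →L[ℂ] ℂ := ∑ Y, ((ϕ Y : ℝ) : ℂ) • EuclideanSpace.proj (𝕜 := ℂ) Y
  have hL : ∀ ζ, L ζ = ∑ Y, ζ Y * ((ϕ Y : ℝ) : ℂ) := by
    intro ζ
    simp [L, mul_comm]
  have hW : cumulantFn Ψ t ϕ = fun ζ => (t : ℂ) * Ψ ζ + L ζ := by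
    ext ζ
    rw [cumulantFn, hL]
  rw [hW, setDeriv_add (analyticAt_const.fun_mul hΨ.analytic) (L.analyticAt 0),
    setDeriv_const_mul _ _ _ hΨ.analytic, setDeriv_clm _ hB, add_comm]
  congr 1
  rw [LabelledGraph.outerWeight]
  refine if_congr Iff.rfl (Finset.prod_congr rfl fun a _ => ?_) rfl
  simp [hL]

theorem connectedSum_congr {α ι : Type*} [Fintype α] [DecidableEq ι] (π : α → ι)
    {w w' : Finset α → ℂ} (h : ∀ B, B.Nonempty → w B = w' B) (S : Finset ι) :
    connectedSum π w S = connectedSum π w' S := by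
  classical
  rw [connectedSum, connectedSum]
  refine Finset.sum_congr rfl fun P hP => Finset.prod_congr rfl fun B hB => ?_
  exact h B ((mem_setPartitions.1 (Finset.mem_filter.1 hP).1).nonempty hB)

/-! ### Connected graphs and cumulants of the potential -/

section Coefficients

open scoped SchwartzMap

variable {d : ℕ}

/-- The algebra of real functions of temperate growth. -/
def temperateFunctions (d : ℕ) : Subalgebra ℝ (RSpace d → ℝ) where
  carrier := {f | f.HasTemperateGrowth}
  mul_mem' hf hg := hf.mul hg
  add_mem' hf hg := hf.add hg
  algebraMap_mem' r := Function.HasTemperateGrowth.const r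

/-- The expectation with respect to a complex Schwartz density. -/
def expectation (ρ : 𝓢(RSpace d, ℂ)) : temperateFunctions d →ₗ[ℝ] ℂ where
  toFun f := ∫ x, ((f.1 x : ℝ) : ℂ) * ρ x
  map_add' f g := by
    rw [← integral_add (integrable_mul_schwartz f.2 ρ) (integrable_mul_schwartz g.2 ρ)]
    refine integral_congr_ae (Eventually.of_forall fun x => ?_)
    simp [add_mul]
  map_smul' c f := by
    rw [RingHom.id_apply, ← integral_smul]
    refine integral_congr_ae (Eventually.of_forall fun x => ?_)
    simp [mul_assoc]

theorem expectation_apply (ρ : 𝓢(RSpace d, ℂ)) (f : temperateFunctions d) :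
    expectation ρ f = ∫ x, ((f.1 x : ℝ) : ℂ) * ρ x := rfl

/-- The monomial `∏ i, x (X i)`. -/
def temperateMonomial {p : ℕ} (X : Fin p → Fin d) : temperateFunctions d :=
  ⟨fun x => ∏ i, x (X i), hasTemperateGrowth_prod_coord Finset.univ X⟩

/-- The potential as an element of the algebra of temperate functions. -/
def temperatePotential (lam : Tensors d) (pbar : ℕ) : temperateFunctions d :=
  ∑ q ∈ Finset.range (pbar + 1), ∑ X, lam q X • temperateMonomial X

theorem temperatePotential_apply (lam : Tensors d) (pbar : ℕ) (x : RSpace d) :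
    (temperatePotential lam pbar).1 x = potential lam pbar x := by
  simp [temperatePotential, potential, homPart, temperateMonomial, Finset.sum_apply]

theorem expectation_temperatePotential_pow (ρ : 𝓢(RSpace d, ℂ)) (lam : Tensors d) (pbar n : ℕ) :
    expectation ρ (temperatePotential lam pbar ^ n) =
      ∫ x, ((potential lam pbar x ^ n : ℝ) : ℂ) * ρ x := by
  rw [expectation_apply]
  simp only [← temperatePotential_apply]
  rfl

/-- If the moments of `ρ` have the cumulants `w`, then the joint cumulants of monomials are the
sums over the partitions of their variables that connect the monomials. -/
theorem jointCumulant_temperateMonomial {m : ℕ} {p : Fin m → ℕ} {ρ : 𝓢(RSpace d, ℂ)}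
    {w : Finset (Legs p) → ℂ} (X : Legs p → Fin d)
    (hρ : ∀ S : Finset (Legs p), ∫ x, (∏ a ∈ S, ((x (X a) : ℝ) : ℂ)) * ρ x = partitionSum w S)
    (hm : 0 < m) :
    jointCumulant (expectation ρ) (fun j => temperateMonomial fun i => X ⟨j, i⟩) Finset.univ =
      connectedSum (Sigma.fst : Legs p → Fin m) w Finset.univ := by
  have hprod : ∀ S : Finset (Fin m),
      expectation ρ (∏ j ∈ S, temperateMonomial fun i => X ⟨j, i⟩) =
        partitionSum w (fiber (Sigma.fst : Legs p → Fin m) S) := by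
    intro S
    rw [← hρ, expectation_apply]
    refine integral_congr_ae (Eventually.of_forall fun x => ?_)
    have hfib : fiber (Sigma.fst : Legs p → Fin m) S = S.sigma fun _ => Finset.univ := by
      ext a
      simp
    simp only [hfib, Finset.prod_sigma]
    congr 1
    rw [SubmonoidClass.coe_finsetProd, Finset.prod_apply]
    push_cast
    refine Finset.prod_congr rfl fun j _ => ?_
    simp [temperateMonomial]
  have hone : expectation ρ 1 = 1 := by
    have := hprod ∅
    rw [Finset.prod_empty] at this
    rw [this, show fiber (Sigma.fst : Legs p → Fin m) ∅ = ∅ by ext; simp, partitionSum_empty]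
  refine (eq_jointCumulant hone (C := connectedSum (Sigma.fst : Legs p → Fin m) w)
    (fun S s hs => ?_) ⟨⟨0, hm⟩, Finset.mem_univ _⟩).symm
  simp only [hprod]
  exact partitionSum_fiber_eq_sum_connectedSum _ w S hs

/-- The sum of the values of the connected Feynman graphs is a cumulant of the potential. -/
theorem sum_connectedGraphs_value_eq_cumulantSeq {Ψ : CSpace d → ℂ} (hΨ : IsAdmissibleSymbol Ψ)
    (lam : Tensors d) (pbar : ℕ) (t : ℝ) (ϕ : RSpace d) {ρ : 𝓢(RSpace d, ℂ)}
    (hρ : ∀ (α : Type) [DecidableEq α] (X : α → Fin d) (S : Finset α),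
      ∫ x, (∏ a ∈ S, ((x (X a) : ℝ) : ℂ)) * ρ x = partitionSum (fun B =>
        setDeriv (fun a => EuclideanSpace.single (X a) (1 : ℂ)) B (cumulantFn Ψ t ϕ) 0) S)
    {m : ℕ} (hm : 0 < m) :
    ∑ G : ConnectedGraphs lam pbar m, G.1.2.value Ψ lam t ϕ =
      cumulantSeq (fun n => ∫ x, ((potential lam pbar x ^ n : ℝ) : ℂ) * ρ x) m := by
  classical
  have hone : expectation ρ 1 = 1 := by
    have := hρ (Fin 0) Fin.elim0 ∅
    rw [partitionSum_empty] at this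
    rw [← this, expectation_apply]
    simp
  -- Expand the cumulant of `V = ∑ λ_X x_X` multilinearly.
  set F : (Fin m → ℕ) → ℂ := fun p => ∑ X : Legs p → Fin d,
    (∏ j : Fin m, ((lam (p j) fun i => X ⟨j, i⟩ : ℝ) : ℂ)) *
      connectedSum (Sigma.fst : Legs p → Fin m) (fun B =>
        LabelledGraph.outerWeight ϕ X B + (t : ℂ) * LabelledGraph.setCoeff Ψ X B)
        Finset.univ with hF
  have hcum : cumulantSeq (fun n => ∫ x, ((potential lam pbar x ^ n : ℝ) : ℂ) * ρ x) m =
      ∑ p ∈ Fintype.piFinset fun _ : Fin m => Finset.range (pbar + 1), F p := by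
    simp only [← expectation_temperatePotential_pow]
    have h1 := jointCumulant_const hone (temperatePotential lam pbar)
      (S := (Finset.univ : Finset (Fin m))) ⟨⟨0, hm⟩, Finset.mem_univ _⟩
    rw [Finset.card_univ, Fintype.card_fin] at h1
    rw [← h1]
    change cumulantMultilinear (expectation ρ) (fun _ : Fin m => temperatePotential lam pbar) = _
    simp only [temperatePotential]
    rw [MultilinearMap.map_sum_finset]
    refine Finset.sum_congr rfl fun p _ => ?_
    rw [MultilinearMap.map_sum, hF]
    refine (Fintype.sum_equiv (Equiv.piCurry fun _ _ => Fin d) _ _ fun X => ?_).symm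
    rw [MultilinearMap.map_smul_univ, Complex.real_smul, Complex.ofReal_prod]
    congr 1
    refine Eq.trans ?_ (jointCumulant_temperateMonomial X (hρ (Legs p) X) hm).symm
    exact connectedSum_congr _ (fun B hB => (setDeriv_cumulantFn hΨ t ϕ X hB).symm) _
  -- Full vertices whose coupling tensor vanishes do not occur in graphs.
  have hvanish : ∀ p : Fin m → ℕ, (¬ ∀ j, lam (p j) ≠ 0) → F p = 0 := by
    intro p hp
    push Not at hp
    obtain ⟨j, hj⟩ := hp
    refine Finset.sum_eq_zero fun X _ => ?_
    rw [Finset.prod_eq_zero (Finset.mem_univ j) (by simp [hj]), zero_mul]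
  have hmem : ∀ p : Fin m → ℕ,
      p ∈ (Fintype.piFinset fun _ : Fin m => Finset.range (pbar + 1)).filter
        (fun p => ∀ j, lam (p j) ≠ 0) ↔ ∀ j, p j ≤ pbar ∧ lam (p j) ≠ 0 := by
    intro p
    simp [Fintype.mem_piFinset, forall_and]
  have : Fintype (LegNumbers lam pbar m) := Fintype.ofFinite _
  have : ∀ p : LegNumbers lam pbar m, Fintype {G : FeynmanGraph p.1 // G.IsConnected} :=
    fun p => Fintype.ofFinite _
  let e : ConnectedGraphs lam pbar m ≃
      Σ p : LegNumbers lam pbar m, {G : FeynmanGraph p.1 // G.IsConnected} :=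
    { toFun := fun G => ⟨G.1.1, G.1.2, G.2⟩
      invFun := fun G => ⟨⟨G.1, G.2.1⟩, G.2.2⟩
      left_inv := fun _ => rfl
      right_inv := fun _ => rfl }
  have hsum : ∑ G : ConnectedGraphs lam pbar m, G.1.2.value Ψ lam t ϕ =
      ∑ G : (Σ p : LegNumbers lam pbar m, {G : FeynmanGraph p.1 // G.IsConnected}),
        G.2.1.value Ψ lam t ϕ := Fintype.sum_equiv e _ _ fun _ => rfl
  rw [hcum, hsum, Fintype.sum_sigma]
  simp only [FeynmanGraph.sum_value_eq_sum_connectedSum]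
  rw [← Finset.sum_filter_of_ne (p := fun p => ∀ j, lam (p j) ≠ 0)
    (fun p _ h => not_not.1 fun h' => h (hvanish p h')), Finset.sum_subtype _ hmem F]

end Coefficients

end LevyFeynman

end

theorem theorem2p17 (d : ℕ) (Ψ : LevyFeynman.CSpace d → ℂ)
    (hΨ : LevyFeynman.IsAdmissibleSymbol Ψ)
    (lam : LevyFeynman.Tensors d) (pbar : ℕ)
    (hlam : LevyFeynman.IsAdmissiblePotential lam pbar)
    (t : ℝ) (ht : 0 < t) (ϕ : LevyFeynman.RSpace d) :
    (∀ᶠ β in 𝓝[>] (0 : ℝ), LevyFeynman.solution Ψ lam pbar t β ϕ ≠ 0) ∧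
    LevyFeynman.IsAsymptoticSeries
      (fun β : ℝ => Complex.log (LevyFeynman.solution Ψ lam pbar t β ϕ))
      (LevyFeynman.connectedCoeff Ψ lam pbar t ϕ) := by
  obtain ⟨ρ, hρ, hexp⟩ := LevyFeynman.exists_density hΨ hlam ht ϕ
  set a : ℕ → ℂ := fun n => ∫ x, ((LevyFeynman.potential lam pbar x ^ n : ℝ) : ℂ) * ρ x
    with ha
  have ha0 : a 0 = 1 := by
    have := hρ (Fin 0) Fin.elim0 ∅
    rw [LevyFeynman.partitionSum_empty] at this
    simpa [ha] using this
  have hF : ∀ N : ℕ, (fun β : ℝ => LevyFeynman.solution Ψ lam pbar t β ϕ -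
      ∑ m ∈ Finset.range (N + 1), (-(β : ℂ)) ^ m / m.factorial * a m) =O[𝓝[>] 0]
      fun β : ℝ => β ^ (N + 1) := by
    intro N
    obtain ⟨C, hC⟩ := hexp N
    refine Asymptotics.IsBigO.of_bound C ?_
    filter_upwards [Ioc_mem_nhdsGT one_pos] with β hβ
    rw [Real.norm_of_nonneg (pow_nonneg hβ.1.le _)]
    exact hC β hβ.1 hβ.2
  refine ⟨(LevyFeynman.tendsto_one_of_moments ha0 (hF 0)).eventually_ne one_ne_zero, fun N => ?_⟩
  have hlog := LevyFeynman.log_isBigO_of_moments ha0 hF N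
  have hcoeff : ∀ (β : ℝ) (m : ℕ), (β : ℂ) ^ m * LevyFeynman.connectedCoeff Ψ lam pbar t ϕ m =
      (-(β : ℂ)) ^ m / m.factorial * LevyFeynman.cumulantSeq a m := by
    intro β m
    rcases Nat.eq_zero_or_pos m with rfl | hm
    · rw [LevyFeynman.connectedCoeff, if_pos rfl, LevyFeynman.cumulantSeq, mul_zero, mul_zero]
    · rw [LevyFeynman.connectedCoeff, if_neg hm.ne',
        LevyFeynman.sum_connectedGraphs_value_eq_cumulantSeq hΨ lam pbar t ϕ hρ hm, neg_pow]
      ring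
  simp only [hcoeff]
  have hβ : (fun β : ℝ => (β ^ N)⁻¹ * β ^ (N + 1)) =ᶠ[𝓝[>] 0] fun β : ℝ => β := by
    filter_upwards [self_mem_nhdsWithin] with β hβ
    have : β ≠ 0 := (Set.mem_Ioi.1 hβ).ne'
    field_simp
    ring
  have h0 : Tendsto (fun β : ℝ => β) (𝓝[>] 0) (𝓝 0) := tendsto_id.mono_left nhdsWithin_le_nhds
  exact (((Asymptotics.isBigO_refl (fun β : ℝ => (β ^ N)⁻¹) _).mul hlog.norm_left).trans_eventuallyEq
    hβ).trans_tendsto h0
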